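/- Let $(M,g)$ be a smooth four-dimensional Lorentzian manifold of signature $(-,+,+,+)$ satisfying the Einstein vacuum equations $R_{\mu\nu}-\frac12 R g_{\mu\nu}=0$. Let $\Sigma$ be a smoothly immersed three-dimensional spatial hypersurface with flat induced metric, described in Cartesian coordinates: an open set $U\subseteq\mathbb R^3$ and a smooth map $\iota:U\to M$ with induced metric $\gamma_{ij}=g(\partial_i,\partial_j)=\delta_{ij}$, where $\partial_i=d\iota(\partial/\partial x^i)$. Let $n$ be a smooth unit normal field along $\Sigma$, $g(n,n)=-1$, $g(n,\partial_i)=0$. Define * the extrinsic curvature $K_{ij}=-g(\nabla_i n,\partial_j)$, its trace $K=K^i{}_i$, and the ADM momentum $P_{ij}=-K_{ij}+K\gamma_{ij}$; * the magnetic part of the Weyl tensor $W$ (with the convention $(\nabla_\mu\nabla_\nu-\nabla_\nu\nabla_\mu)v^\rho=R^\rho{}_{\sigma\mu\nu}v^\sigma$), $B_{ij}=W^*_{\alpha\mu\nu\beta}\,n^\mu n^\nu(\partial_i)^\alpha(\partial_j)^\beta$, with $W^*_{\alpha\beta\mu\nu}=\frac12W_{\alpha\beta\lambda\delta}\,\varepsilon^{\lambda\delta}{}_{\mu\nu}$,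 where $\varepsilon$ is the volume form of $g$ along $\Sigma$ with $\varepsilon(n,\partial_1,\partial_2,\partial_3)=1$; * for $\mathbf k=1,2,3$, the generators of translations $\mathcal T_{\mathbf k}=\partial/\partial x^k$ and of rotations $\mathcal R_{\mathbf k}=\varepsilon_k{}^{ij}x_i\,\partial/\partial x^j$, with $\varepsilon_{123}=1$. Assume that the three-dimensional covariant divergence of the magnetic part vanishes: $B^i{}_{j|i}=0$ on $\Sigma$. Then for every smooth closed (compact, without boundary) two-dimensional surface $A$ immersed in $\Sigma$ with a continuous unit normal field $\nu$, and for every $\mathbf k$, $$\int_A B^i{}_j\,\mathcal R^j_{\mathbf k}\,dS_i=\int_A P^i{}_j\,\mathcal T^j_{\mathbf k}\,dS_i ,$$ where $dS_i=\nu_i\,dS$ and $dS$ is the area element of $A$. -/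

import Mathlib

open scoped Manifold ContDiff

noncomputable section

namespace FlatSlice

/-! ## Index notation -/

/-- Model space of spacetime coordinates `x⁰, …, x³`. -/
abbrev E4 : Type := EuclideanSpace ℝ (Fin 4)

/-- Euclidean three-space with its Cartesian coordinates. -/
abbrev E3 : Type := EuclideanSpace ℝ (Fin 3)

/-- Coordinate domain of a surface. -/
abbrev E2 : Type := EuclideanSpace ℝ (Fin 2)

/-- The partial derivative `∂_i f` at `x`. -/
def pderiv {d : ℕ} (i : Fin d) (f : EuclideanSpace ℝ (Fin d) → ℝ)
    (x : EuclideanSpace ℝ (Fin d)) : ℝ :=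
  fderiv ℝ f x (EuclideanSpace.single i 1)

/-- The Kronecker delta. -/
def delta {d : ℕ} (i j : Fin d) : ℝ := if i = j then 1 else 0

/-- The Levi-Civita symbol `[a₀ a₁ … a_{d-1}]`: the sign of `a` if it is a permutation of
`0, …, d-1`, and `0` otherwise, written as the determinant of the matrix `δ_{a(i) j}`. -/
def leviCivita {d : ℕ} (a : Fin d → Fin d) : ℝ :=
  (Matrix.of fun i j => (if a i = j then (1 : ℝ) else 0)).det

/-! ## Curvature of a metric given by its components `G = (g_{μν})` in a coordinate system -/

section Coordinates

variable (G : E4 → Matrix (Fin 4) (Fin 4) ℝ)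

/-- The inverse metric `g^{μν}`. -/
def gInv (y : E4) (μ ν : Fin 4) : ℝ := (G y)⁻¹ μ ν

/-- Christoffel symbols `Γ^ρ_{μν} = ½ g^{ρσ} (∂_μ g_{σν} + ∂_ν g_{σμ} - ∂_σ g_{μν})`. -/
def christoffel (ρ μ ν : Fin 4) (y : E4) : ℝ :=
  (1 / 2) * ∑ σ, gInv G y ρ σ *
    (pderiv μ (fun z => G z σ ν) y + pderiv ν (fun z => G z σ μ) y
      - pderiv σ (fun z => G z μ ν) y)

/-- The Riemann tensor `R^ρ_{σμν}`, with `(∇_μ ∇_ν - ∇_ν ∇_μ) v^ρ = R^ρ_{σμν} v^σ`. -/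
def riemannUp (ρ σ μ ν : Fin 4) (y : E4) : ℝ :=
  pderiv μ (christoffel G ρ ν σ) y - pderiv ν (christoffel G ρ μ σ) y
    + ∑ κ, (christoffel G ρ μ κ y * christoffel G κ ν σ y
      - christoffel G ρ ν κ y * christoffel G κ μ σ y)

/-- The Riemann tensor `R_{αβμν}` with all indices down. -/
def riemann (α β μ ν : Fin 4) (y : E4) : ℝ := ∑ ρ, G y α ρ * riemannUp G ρ β μ ν y

/-- The Ricci tensor `R_{μν} = R^ρ_{μρν}`. -/
def ricci (μ ν : Fin 4) (y : E4) : ℝ := ∑ ρ, riemannUp G ρ μ ρ ν y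

/-- The curvature scalar `R = g^{μν} R_{μν}`. -/
def scalarCurv (y : E4) : ℝ := ∑ μ, ∑ ν, gInv G y μ ν * ricci G μ ν y

/-- The Einstein tensor `R_{μν} - ½ R g_{μν}`. -/
def einstein (μ ν : Fin 4) (y : E4) : ℝ := ricci G μ ν y - (1 / 2) * scalarCurv G y * G y μ ν

/-- The Weyl tensor
`W_{αβμν} = R_{αβμν} - (g_{α[μ} R_{ν]β} - g_{β[μ} R_{ν]α}) + ⅓ R g_{α[μ} g_{ν]β}`. -/
def weyl (α β μ ν : Fin 4) (y : E4) : ℝ :=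
  riemann G α β μ ν y
    - ((1 / 2) * (G y α μ * ricci G ν β y - G y α ν * ricci G μ β y)
      - (1 / 2) * (G y β μ * ricci G ν α y - G y β ν * ricci G μ α y))
    + (1 / 3) * scalarCurv G y * ((1 / 2) * (G y α μ * G y ν β - G y α ν * G y μ β))

/-- The volume form `ε_{αβμν}` of the metric, for the orientation in which the frame with
component matrix `F` (the `a`-th vector of the frame has components `F μ a`) is positive. -/
def volForm (F : Matrix (Fin 4) (Fin 4) ℝ) (α β μ ν : Fin 4) (y : E4) : ℝ :=
  Real.sign F.det * Real.sqrt |(G y).det| * leviCivita ![α, β, μ, ν]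

/-- The right dual `W*_{αβμν} = ½ W_{αβλδ} ε^{λδ}_{μν}` of the Weyl tensor. -/
def weylDual (F : Matrix (Fin 4) (Fin 4) ℝ) (α β μ ν : Fin 4) (y : E4) : ℝ :=
  (1 / 2) * ∑ l, ∑ d, ∑ ρ, ∑ σ,
    weyl G α β l d y * gInv G y l ρ * gInv G y d σ * volForm G F ρ σ μ ν y

end Coordinates

/-! ## Spacetimes -/

section Spacetime

variable {M : Type*} [TopologicalSpace M] [ChartedSpace E4 M]

/-- The coordinate vector field `∂_μ` of the preferred chart around `p₀`, at the point with
coordinates `y`. -/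
def coordVec (p₀ : M) (y : E4) (μ : Fin 4) : TangentSpace (𝓡 4) ((chartAt E4 p₀).symm y) :=
  mfderiv (𝓡 4) (𝓡 4) (chartAt E4 p₀).symm y (EuclideanSpace.single μ (1 : ℝ) : E4)

/-- The component `v^μ` of `v ∈ T_p M` in the preferred chart around `p₀`. -/
def vecComp (p₀ p : M) (v : TangentSpace (𝓡 4) p) (μ : Fin 4) : ℝ :=
  (EuclideanSpace.proj μ : E4 →L[ℝ] ℝ) (mfderiv (𝓡 4) (𝓡 4) (chartAt E4 p₀) p v)

variable (M) in
/-- A smooth Lorentzian metric of signature `(-,+,+,+)` on a four-manifold. -/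
structure LorentzMetric where
  /-- the bilinear form on each tangent space -/
  val : ∀ p : M, TangentSpace (𝓡 4) p →L[ℝ] TangentSpace (𝓡 4) p →L[ℝ] ℝ
  symm : ∀ p v w, val p v w = val p w v
  signature : ∀ p, ∃ b : Module.Basis (Fin 4) ℝ (TangentSpace (𝓡 4) p),
    ∀ μ ν, val p (b μ) (b ν) = if μ = ν then (if μ = 0 then -1 else 1) else 0
  smooth : ∀ (p₀ : M) (μ ν : Fin 4),
    ContDiffOn ℝ ∞ (fun y => val _ (coordVec p₀ y μ) (coordVec p₀ y ν)) (chartAt E4 p₀).target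

variable (g : LorentzMetric M)

/-- The components `g_{μν}` of the metric in the preferred chart around `p₀`. -/
def LorentzMetric.comp (p₀ : M) (y : E4) : Matrix (Fin 4) (Fin 4) ℝ :=
  Matrix.of fun μ ν => g.val _ (coordVec p₀ y μ) (coordVec p₀ y ν)

/-- The Einstein vacuum equations `R_{μν} - ½ R g_{μν} = 0` on all of `M`. -/
def LorentzMetric.IsVacuum : Prop :=
  ∀ (p : M) (μ ν : Fin 4), einstein (g.comp p) μ ν (chartAt E4 p p) = 0

/-! ## Flat spatial hypersurfaces, in Cartesian coordinates `x ∈ U ⊆ ℝ³` -/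

/-- The tangent vector `∂_i` of the hypersurface `ι`, as a vector of spacetime. -/
def tangentVec (ι : E3 → M) (x : E3) (i : Fin 3) : TangentSpace (𝓡 4) (ι x) :=
  mfderiv (𝓡 3) (𝓡 4) ι x (EuclideanSpace.single i (1 : ℝ) : E3)

/-- `ι : U → M` is a smoothly immersed spatial hypersurface with flat induced metric, `x ∈ U` being
Cartesian coordinates on it (`γ_{ij} = δ_{ij}`), and `n` is its smooth timelike unit normal. -/
structure IsFlatSlice (U : Set E3) (ι : E3 → M) (n : ∀ x : E3, TangentSpace (𝓡 4) (ι x)) :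
    Prop where
  isOpen : IsOpen U
  smooth : ContMDiffOn (𝓡 3) (𝓡 4) ∞ ι U
  flat : ∀ x ∈ U, ∀ i j, g.val (ι x) (tangentVec ι x i) (tangentVec ι x j) = delta i j
  smooth_normal : ∀ (p₀ : M) (μ : Fin 4),
    ContDiffOn ℝ ∞ (fun x => vecComp p₀ (ι x) (n x) μ) (U ∩ ι ⁻¹' (chartAt E4 p₀).source)
  unit_normal : ∀ x ∈ U, g.val (ι x) (n x) (n x) = -1
  normal : ∀ x ∈ U, ∀ i, g.val (ι x) (n x) (tangentVec ι x i) = 0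

variable (ι : E3 → M) (n : ∀ x : E3, TangentSpace (𝓡 4) (ι x))

/-- The components `(∇_i n)^μ = ∂_i n^μ + Γ^μ_{αβ} (∂_i)^α n^β` at `x` of the covariant derivative
of the unit normal along the hypersurface (in the preferred chart around `ι x`). -/
def covDerivNormal (x : E3) (i : Fin 3) (μ : Fin 4) : ℝ :=
  pderiv i (fun z => vecComp (ι x) (ι z) (n z) μ) x
    + ∑ α, ∑ β, christoffel (g.comp (ι x)) μ α β (chartAt E4 (ι x) (ι x))
      * vecComp (ι x) (ι x) (tangentVec ι x i) α * vecComp (ι x) (ι x) (n x) β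

/-- The extrinsic curvature `K_{ij} = -g(∇_i n, ∂_j)`. -/
def extrinsicCurv (x : E3) (i j : Fin 3) : ℝ :=
  - ∑ μ, ∑ ν, g.comp (ι x) (chartAt E4 (ι x) (ι x)) μ ν
      * covDerivNormal g ι n x i μ * vecComp (ι x) (ι x) (tangentVec ι x j) ν

/-- The ADM momentum `P_{ij} = -K_{ij} + K γ_{ij}`, with `K = K^i_i` and `γ_{ij} = δ_{ij}`. -/
def admMomentum (x : E3) (i j : Fin 3) : ℝ :=
  - extrinsicCurv g ι n x i j + (∑ l, extrinsicCurv g ι n x l l) * delta i j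

/-- The matrix whose columns are the components of the frame `(n, ∂_1, ∂_2, ∂_3)` at `ι x`. -/
def frameMatrix (x : E3) : Matrix (Fin 4) (Fin 4) ℝ :=
  Matrix.of fun μ a =>
    Fin.cons (α := fun _ => ℝ) (vecComp (ι x) (ι x) (n x) μ)
      (fun i : Fin 3 => vecComp (ι x) (ι x) (tangentVec ι x i) μ) a

/-- The magnetic part `B_{ij} = W*_{αμνβ} n^μ n^ν` of the Weyl tensor, in components along the
hypersurface. Spacetime is oriented so that `(n, ∂_1, ∂_2, ∂_3)` is a positive frame. -/
def magneticPart (x : E3) (i j : Fin 3) : ℝ :=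
  ∑ α, ∑ μ, ∑ ν, ∑ β,
    weylDual (g.comp (ι x)) (frameMatrix ι n x) α μ ν β (chartAt E4 (ι x) (ι x))
      * vecComp (ι x) (ι x) (n x) μ * vecComp (ι x) (ι x) (n x) ν
      * vecComp (ι x) (ι x) (tangentVec ι x i) α * vecComp (ι x) (ι x) (tangentVec ι x j) β

end Spacetime

/-! ## Conformal Killing fields of flat space -/

/-- The translation generator `𝒯_k = ∂/∂x^k`. -/
def translationGen (k : Fin 3) (_x : E3) (j : Fin 3) : ℝ := delta k j

/-- The rotation generator `ℛ_k = ε_k^{ij} x_i ∂/∂x^j`. -/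
def rotationGen (k : Fin 3) (x : E3) (j : Fin 3) : ℝ := ∑ i, leviCivita ![k, i, j] * x i

/-! ## Closed surfaces and flux integrals -/

section Surface

variable {A : Type*} [TopologicalSpace A] [ChartedSpace E2 A]

/-- `f` is a smooth immersion of the surface `A` in `U ⊆ ℝ³`, and `ν` is a continuous unit normal
field of it. -/
structure IsSurfaceIn (U : Set E3) (f ν : A → E3) : Prop where
  mem : ∀ a, f a ∈ U
  smooth : ContMDiff (𝓡 2) (𝓡 3) ∞ f
  immersion : ∀ a, Function.Injective (mfderiv (𝓡 2) (𝓡 3) f a)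
  continuous_normal : Continuous ν
  unit_normal : ∀ a, ‖ν a‖ = 1
  normal : ∀ (a : A) (v : TangentSpace (𝓡 2) a),
    inner ℝ (ν a) (mfderiv (𝓡 2) (𝓡 3) f a v : E3) = 0

/-- The area density `√(|∂₁f|² |∂₂f|² - ⟨∂₁f, ∂₂f⟩²)` at the point with coordinates `u` in the
preferred chart around `a`. -/
def areaDensity (f : A → E3) (a : A) (u : E2) : ℝ :=
  let D : E2 →L[ℝ] E3 := fderiv ℝ (fun w => f ((chartAt E2 a).symm w)) u
  let d₁ : E3 := D (EuclideanSpace.single 0 1)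
  let d₂ : E3 := D (EuclideanSpace.single 1 1)
  Real.sqrt (‖d₁‖ ^ 2 * ‖d₂‖ ^ 2 - (inner ℝ d₁ d₂) ^ 2)

/-- The flux `∫_A V^i dS_i`, `dS_i = ν_i dS`, of the vector field `V` on `ℝ³` through the surface
`f : A → ℝ³` with unit normal `ν`, computed with a partition of unity `ρ` on `A` subordinate to the
charts of `A`. -/
def flux (ρ : SmoothPartitionOfUnity A (𝓡 2) A Set.univ) (f ν : A → E3)
    (V : E3 → Fin 3 → ℝ) : ℝ :=
  ∑ᶠ a : A, ∫ u in (chartAt E2 a).target,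
    ρ a ((chartAt E2 a).symm u)
      * (∑ i, V (f ((chartAt E2 a).symm u)) i * ν ((chartAt E2 a).symm u) i)
      * areaDensity f a u

end Surface

end FlatSlice

end

open scoped Manifold ContDiff

noncomputable section

namespace FlatSlice

/-! ## Calculus of partial derivatives -/

section PartialDerivatives

variable {d : ℕ} {V : Set (EuclideanSpace ℝ (Fin d))} {x : EuclideanSpace ℝ (Fin d)}
  {f h : EuclideanSpace ℝ (Fin d) → ℝ}

/-! The two flux densities differ by a curl, and a curl has no flux through a closed surface.

Write `D_{abc} = ∂_a K_{bc}`. Flatness in Cartesian coordinates means that the induced connection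
vanishes (`gdot_covD_tvec`), so the Codazzi equation involves only partial derivatives: `R(∂_i, n,
∂_a, ∂_b) = -∂_a K_{bi} + ∂_b K_{ai}` (`codazzi`). In vacuum the Ricci tensor vanishes and the Weyl
tensor is the Riemann tensor. Tracing Codazzi over an orthonormal frame gives the momentum
constraint `∂_i K_{bi} = ∂_b K_{ii}` (`momentum_constraint`); dualising it gives `B_{ij} = -ε_{jab}
∂_a K_{bi}` (`magnetic_eq`). The momentum constraint says exactly that `ε_{jab} ∂_a K_{bi}` is
symmetric in `i, j`.

Take the potential `Z_b = -K_{bj} ℛ_k^j`. In `curl Z` the derivative falls either on `K`, which by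
this symmetry gives `B_{ij} ℛ_k^j`, or on `ℛ_k`, where `∂_a ℛ_k^j = ε_{kaj}` and contracting two
Levi-Civita symbols gives `K_{ik} - K δ_{ik} = -P_{ij} 𝒯_k^j`. Hence `B·ℛ_k - P·𝒯_k = curl Z`
(`curl_contraction`, `magnetic_sub_momentum`).

Since `K` at each point is defined in a chart centred at that point, differentiating it requires
chart independence (`extrinsicIn_transition`). This rests on `-2K` being the first variation of the
induced metric along the normal.

Finally `(curl Z · ν) dS` is, with the orientation given by `ν`, the two-form `d⟨Z ∘ f, df⟩`. Its
integral vanishes by Stokes' theorem (`sum_integral_stokesDensity`), obtained from partitions of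
unity, change of variables and the vanishing integral of a derivative with compact support. -/

theorem pderiv_congr {i : Fin d} (hfh : f =ᶠ[nhds x] h) : pderiv i f x = pderiv i h x := by
  rw [pderiv, pderiv, hfh.fderiv_eq]

theorem pderiv_add {i : Fin d} (hf : DifferentiableAt ℝ f x) (hh : DifferentiableAt ℝ h x) :
    pderiv i (fun z => f z + h z) x = pderiv i f x + pderiv i h x := by
  simp [pderiv, fderiv_fun_add hf hh]

theorem pderiv_neg {i : Fin d} : pderiv i (fun z => - f z) x = - pderiv i f x := by
  simp [pderiv, fderiv_fun_neg]

theorem pderiv_const {i : Fin d} (c : ℝ) : pderiv i (fun _ => c) x = 0 := by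
  simp [pderiv]

theorem pderiv_mul {i : Fin d} (hf : DifferentiableAt ℝ f x) (hh : DifferentiableAt ℝ h x) :
    pderiv i (fun z => f z * h z) x = pderiv i f x * h x + f x * pderiv i h x := by
  simp [pderiv, fderiv_fun_mul hf hh]; ring

theorem pderiv_sum {κ : Type*} {s : Finset κ} {F : κ → EuclideanSpace ℝ (Fin d) → ℝ} {i : Fin d}
    (hF : ∀ j ∈ s, DifferentiableAt ℝ (F j) x) :
    pderiv i (fun z => ∑ j ∈ s, F j z) x = ∑ j ∈ s, pderiv i (F j) x := by
  simp [pderiv, fderiv_fun_sum hF]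

theorem fderiv_eq_sum_pderiv (v : EuclideanSpace ℝ (Fin d)) :
    fderiv ℝ f x v = ∑ i, pderiv i f x * v i := by
  have : v = ∑ i, v i • EuclideanSpace.single i (1 : ℝ) := by
    ext j
    simp [Pi.single_apply]
  conv_lhs => rw [this]
  simp [map_sum, pderiv, mul_comm]

theorem pderiv_apply {i j : Fin d} : pderiv i (fun z => z j) x = delta i j := by
  have : HasFDerivAt (fun z : EuclideanSpace ℝ (Fin d) => z j)
      (EuclideanSpace.proj j : EuclideanSpace ℝ (Fin d) →L[ℝ] ℝ) x :=
    (EuclideanSpace.proj j : EuclideanSpace ℝ (Fin d) →L[ℝ] ℝ).hasFDerivAt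
  rw [pderiv, this.fderiv]
  simp [delta, eq_comm]

theorem pderiv_component {m : ℕ} {y : EuclideanSpace ℝ (Fin m) → EuclideanSpace ℝ (Fin d)}
    {u : EuclideanSpace ℝ (Fin m)} (hy : DifferentiableAt ℝ y u) {i : Fin m} {j : Fin d} :
    pderiv i (fun z => y z j) u = fderiv ℝ y u (EuclideanSpace.single i 1) j := by
  have : HasFDerivAt (fun z => y z j)
      ((EuclideanSpace.proj j : EuclideanSpace ℝ (Fin d) →L[ℝ] ℝ).comp (fderiv ℝ y u)) u :=
    (EuclideanSpace.proj j : EuclideanSpace ℝ (Fin d) →L[ℝ] ℝ).hasFDerivAt.comp u hy.hasFDerivAt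
  rw [pderiv, this.fderiv]
  simp

theorem pderiv_comp {m : ℕ} {y : EuclideanSpace ℝ (Fin m) → EuclideanSpace ℝ (Fin d)}
    {u : EuclideanSpace ℝ (Fin m)} (hf : DifferentiableAt ℝ f (y u))
    (hy : DifferentiableAt ℝ y u) {i : Fin m} :
    pderiv i (fun z => f (y z)) u = ∑ l, pderiv l f (y u) * pderiv i (fun z => y z l) u := by
  have : HasFDerivAt (fun z => f (y z)) ((fderiv ℝ f (y u)).comp (fderiv ℝ y u)) u :=
    hf.hasFDerivAt.comp u hy.hasFDerivAt
  rw [pderiv, this.fderiv, ContinuousLinearMap.comp_apply, fderiv_eq_sum_pderiv]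
  simp_rw [pderiv_component hy]

theorem _root_.ContDiffOn.pderiv (hV : IsOpen V) (hf : ContDiffOn ℝ ∞ f V) (i : Fin d) :
    ContDiffOn ℝ ∞ (pderiv i f) V :=
  (hf.fderiv_of_isOpen hV (m := ∞) le_rfl).clm_apply contDiffOn_const

theorem pderiv_comm (hV : IsOpen V) (hf : ContDiffOn ℝ ∞ f V) (hx : x ∈ V) (i j : Fin d) :
    pderiv i (pderiv j f) x = pderiv j (pderiv i f) x := by
  have h2 : ContDiffAt ℝ ∞ f x := hf.contDiffAt (hV.mem_nhds hx)
  have hs : IsSymmSndFDerivAt ℝ f x := h2.isSymmSndFDerivAt (by simpa using ENat.LEInfty.out)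
  have hd : DifferentiableAt ℝ (fderiv ℝ f) x :=
    ((h2.fderiv_right (m := ∞) le_rfl).differentiableAt (by simp))
  have key : ∀ a b : Fin d, FlatSlice.pderiv a (FlatSlice.pderiv b f) x
      = fderiv ℝ (fderiv ℝ f) x (EuclideanSpace.single a 1) (EuclideanSpace.single b 1) := by
    intro a b
    have := hd.hasFDerivAt.clm_apply (hasFDerivAt_const (EuclideanSpace.single b (1 : ℝ)) x)
    rw [FlatSlice.pderiv]
    change fderiv ℝ (fun z => fderiv ℝ f z (EuclideanSpace.single b (1 : ℝ))) x _ = _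
    rw [this.fderiv]
    simp
  rw [key, key, hs.eq]

end PartialDerivatives

/-! ## The Levi-Civita connection along a map -/

section Connection

variable {G : E4 → Matrix (Fin 4) (Fin 4) ℝ} {W : Set E4}

theorem _root_.ContDiffOn.matrix_det {d : ℕ} {E : Type*} [NormedAddCommGroup E] [NormedSpace ℝ E]
    {s : Set E} {H : E → Matrix (Fin d) (Fin d) ℝ}
    (hH : ∀ i j, ContDiffOn ℝ ∞ (fun z => H z i j) s) : ContDiffOn ℝ ∞ (fun z => (H z).det) s := by
  simp_rw [Matrix.det_apply]
  refine ContDiffOn.sum fun σ _ => ContDiffOn.const_smul _ ?_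
  exact contDiffOn_prod fun i _ => hH _ _

/-- The components `G` are those of a smooth metric on the open set `W`. -/
structure IsMetricOn (G : E4 → Matrix (Fin 4) (Fin 4) ℝ) (W : Set E4) : Prop where
  isOpen : IsOpen W
  smooth : ∀ μ ν, ContDiffOn ℝ ∞ (fun z => G z μ ν) W
  symm : ∀ z ∈ W, ∀ μ ν, G z μ ν = G z ν μ
  det_ne : ∀ z ∈ W, (G z).det ≠ 0

namespace IsMetricOn

variable (hG : IsMetricOn G W)
include hG

/-- Cramer's rule: each entry of the adjugate is the determinant of a matrix with smooth entries,
one row of which is a constant basis vector. -/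
theorem smooth_gInv (μ ν : Fin 4) : ContDiffOn ℝ ∞ (fun z => gInv G z μ ν) W := by
  have h : ∀ z, gInv G z μ ν = (G z).det⁻¹ * ((G z).adjugate μ ν) := by
    intro z
    simp [gInv, Matrix.inv_def]
  simp_rw [h, Matrix.adjugate_apply]
  refine ((ContDiffOn.matrix_det hG.smooth).inv hG.det_ne).mul (ContDiffOn.matrix_det fun i j => ?_)
  by_cases hi : i = ν
  · subst hi
    simpa using contDiffOn_const
  · simpa [Matrix.updateRow_ne hi] using hG.smooth i j

theorem smooth_christoffel (ρ μ ν : Fin 4) : ContDiffOn ℝ ∞ (christoffel G ρ μ ν) W := by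
  refine contDiffOn_const.mul (ContDiffOn.sum fun σ _ => (hG.smooth_gInv ρ σ).mul ?_)
  exact (((hG.smooth _ _).pderiv hG.isOpen _).add ((hG.smooth _ _).pderiv hG.isOpen _)).sub
    ((hG.smooth _ _).pderiv hG.isOpen _)

theorem pderiv_symm {z : E4} (hz : z ∈ W) (l μ ν : Fin 4) :
    pderiv l (fun w => G w μ ν) z = pderiv l (fun w => G w ν μ) z :=
  pderiv_congr <| by
    filter_upwards [hG.isOpen.mem_nhds hz] with w hw using hG.symm w hw μ ν

theorem christoffel_symm {z : E4} (hz : z ∈ W) (ρ μ ν : Fin 4) :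
    christoffel G ρ μ ν z = christoffel G ρ ν μ z := by
  unfold christoffel
  congr 1
  refine Finset.sum_congr rfl fun σ _ => ?_
  rw [hG.pderiv_symm hz σ μ ν]
  ring

theorem sum_mul_christoffel {z : E4} (hz : z ∈ W) (α μ ν : Fin 4) :
    ∑ ρ, G z α ρ * christoffel G ρ μ ν z = (1 / 2) * (pderiv μ (fun w => G w α ν) z
      + pderiv ν (fun w => G w α μ) z - pderiv α (fun w => G w μ ν) z) := by
  have hinv : ∀ σ, ∑ ρ, G z α ρ * gInv G z ρ σ = if α = σ then 1 else 0 := by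
    intro σ
    have := congrFun (congrFun (Matrix.mul_nonsing_inv (G z) (hG.det_ne z hz).isUnit) α) σ
    rwa [Matrix.mul_apply, Matrix.one_apply] at this
  set c : Fin 4 → ℝ := fun σ => pderiv μ (fun w => G w σ ν) z
      + pderiv ν (fun w => G w σ μ) z - pderiv σ (fun w => G w μ ν) z with hc
  calc ∑ ρ, G z α ρ * christoffel G ρ μ ν z
      = ∑ ρ, ∑ σ, (1 / 2) * ((G z α ρ * gInv G z ρ σ) * c σ) := by
        refine Finset.sum_congr rfl fun ρ _ => ?_
        rw [christoffel, Finset.mul_sum, Finset.mul_sum]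
        exact Finset.sum_congr rfl fun σ _ => by rw [hc]; ring
    _ = (1 / 2) * ∑ σ, (∑ ρ, G z α ρ * gInv G z ρ σ) * c σ := by
        rw [Finset.sum_comm, Finset.mul_sum]
        exact Finset.sum_congr rfl fun σ _ => by rw [Finset.sum_mul, Finset.mul_sum]
    _ = _ := by simp [hinv, hc]

/-- Metric compatibility in coordinates: in the sum of the two lowered Christoffel symbols every
derivative of `G` cancels except the one in direction `l`. -/
theorem pderiv_metric {z : E4} (hz : z ∈ W) (l μ ν : Fin 4) :
    pderiv l (fun w => G w μ ν) z = ∑ ρ, G z μ ρ * christoffel G ρ l ν z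
      + ∑ ρ, G z ρ ν * christoffel G ρ l μ z := by
  have : ∑ ρ, G z ρ ν * christoffel G ρ l μ z = ∑ ρ, G z ν ρ * christoffel G ρ l μ z :=
    Finset.sum_congr rfl fun ρ _ => by rw [hG.symm z hz]
  rw [this, hG.sum_mul_christoffel hz, hG.sum_mul_christoffel hz, hG.pderiv_symm hz l ν μ,
    hG.pderiv_symm hz ν μ l, hG.pderiv_symm hz μ ν l]
  ring

end IsMetricOn

variable {d : ℕ}

/-- The bilinear form with matrix `H`. -/
def gdot (H : Matrix (Fin 4) (Fin 4) ℝ) (v w : Fin 4 → ℝ) : ℝ := ∑ μ, ∑ ν, H μ ν * v μ * w ν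

/-- The algebra shared by two arguments: `A` is the connection matrix along a map in `pderiv_gdot`,
and the Christoffel symbol contracted with the normal in `extrinsicIn_eq_lie`. -/
theorem sum_connection (H A : Matrix (Fin 4) (Fin 4) ℝ) (X Z : Fin 4 → ℝ) :
    ∑ μ, ∑ ν, (∑ ρ, H μ ρ * A ρ ν + ∑ ρ, H ρ ν * A ρ μ) * X μ * Z ν
      = gdot H (fun ρ => ∑ β, A ρ β * X β) Z + gdot H X (fun ρ => ∑ β, A ρ β * Z β) := by
  have e1 : ∑ μ, ∑ ν, (∑ ρ, H μ ρ * A ρ ν) * X μ * Z ν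
      = ∑ μ, ∑ ν, H μ ν * X μ * ∑ β, A ν β * Z β := by
    refine Finset.sum_congr rfl fun μ _ => ?_
    simp_rw [Finset.sum_mul, Finset.mul_sum]
    rw [Finset.sum_comm]
    exact Finset.sum_congr rfl fun _ _ => Finset.sum_congr rfl fun _ _ => by ring
  have e2 : ∑ μ, ∑ ν, (∑ ρ, H ρ ν * A ρ μ) * X μ * Z ν
      = ∑ μ, ∑ ν, H μ ν * (∑ β, A μ β * X β) * Z ν := by
    simp_rw [Finset.sum_mul, Finset.mul_sum, Finset.sum_mul]
    rw [Finset.sum_comm]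
    conv_rhs => rw [Finset.sum_comm]
    refine Finset.sum_congr rfl fun ν _ => ?_
    rw [Finset.sum_comm]
    exact Finset.sum_congr rfl fun _ _ => Finset.sum_congr rfl fun _ _ => by ring
  simp_rw [add_mul, Finset.sum_add_distrib]
  rw [e1, e2, add_comm]
  rfl

/-- The connection matrix `Γ^ρ_{αβ} ∂_a y^α` along the map `y`. -/
def connForm (G : E4 → Matrix (Fin 4) (Fin 4) ℝ) (y : EuclideanSpace ℝ (Fin d) → E4) (a : Fin d)
    (ρ β : Fin 4) (x : EuclideanSpace ℝ (Fin d)) : ℝ :=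
  ∑ α, christoffel G ρ α β (y x) * pderiv a (fun z => y z α) x

/-- The covariant derivative `∇_a X` of a vector field `X` along the map `y`. -/
def covD (G : E4 → Matrix (Fin 4) (Fin 4) ℝ) (y : EuclideanSpace ℝ (Fin d) → E4) (a : Fin d)
    (X : EuclideanSpace ℝ (Fin d) → Fin 4 → ℝ) (x : EuclideanSpace ℝ (Fin d)) (ρ : Fin 4) : ℝ :=
  pderiv a (fun z => X z ρ) x + ∑ β, connForm G y a ρ β x * X x β

/-- The coordinate vector field `∂_a y` along the map `y`. -/
def tvec (y : EuclideanSpace ℝ (Fin d) → E4) (a : Fin d) (x : EuclideanSpace ℝ (Fin d))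
    (μ : Fin 4) : ℝ :=
  pderiv a (fun z => y z μ) x

variable {V : Set (EuclideanSpace ℝ (Fin d))} {y : EuclideanSpace ℝ (Fin d) → E4}
  {X Z : EuclideanSpace ℝ (Fin d) → Fin 4 → ℝ} {x : EuclideanSpace ℝ (Fin d)}

theorem gdot_symm {H : Matrix (Fin 4) (Fin 4) ℝ} (hH : ∀ μ ν, H μ ν = H ν μ) (v w : Fin 4 → ℝ) :
    gdot H v w = gdot H w v := by
  unfold gdot
  rw [Finset.sum_comm]
  exact Finset.sum_congr rfl fun μ _ => Finset.sum_congr rfl fun ν _ => by rw [hH]; ring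

/-- The map `y` is smooth on the open set `V`, with values in `W`. -/
structure IsSmoothMapOn (y : EuclideanSpace ℝ (Fin d) → E4) (V : Set (EuclideanSpace ℝ (Fin d)))
    (W : Set E4) : Prop where
  isOpen : IsOpen V
  smooth : ContDiffOn ℝ ∞ y V
  mapsTo : Set.MapsTo y V W

section

variable (hG : IsMetricOn G W) (hy : IsSmoothMapOn y V W)
include hy

theorem IsSmoothMapOn.differentiableAt (hx : x ∈ V) : DifferentiableAt ℝ y x :=
  (hy.smooth.contDiffAt (hy.isOpen.mem_nhds hx)).differentiableAt (by simp)

theorem IsSmoothMapOn.diff {h : EuclideanSpace ℝ (Fin d) → ℝ} (hh : ContDiffOn ℝ ∞ h V)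
    (hx : x ∈ V) : DifferentiableAt ℝ h x :=
  (hh.contDiffAt (hy.isOpen.mem_nhds hx)).differentiableAt (by simp)

theorem IsSmoothMapOn.smooth_apply (α : Fin 4) : ContDiffOn ℝ ∞ (fun z => y z α) V :=
  (EuclideanSpace.proj α : E4 →L[ℝ] ℝ).contDiff.comp_contDiffOn hy.smooth

theorem IsSmoothMapOn.smooth_tvec (a : Fin d) (α : Fin 4) :
    ContDiffOn ℝ ∞ (fun z => tvec y a z α) V :=
  (hy.smooth_apply α).pderiv hy.isOpen a

include hG

theorem smooth_connForm (a : Fin d) (ρ β : Fin 4) : ContDiffOn ℝ ∞ (connForm G y a ρ β) V :=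
  ContDiffOn.sum fun α _ => ((hG.smooth_christoffel ρ α β).comp hy.smooth hy.mapsTo).mul
    (hy.smooth_tvec a α)

theorem smooth_covD (a : Fin d) (hX : ∀ μ, ContDiffOn ℝ ∞ (fun z => X z μ) V) (ρ : Fin 4) :
    ContDiffOn ℝ ∞ (fun z => covD G y a X z ρ) V :=
  ((hX ρ).pderiv hy.isOpen a).add
    (ContDiffOn.sum fun β _ => (smooth_connForm hG hy a ρ β).mul (hX β))

theorem smooth_gdot (hX : ∀ μ, ContDiffOn ℝ ∞ (fun z => X z μ) V)
    (hZ : ∀ μ, ContDiffOn ℝ ∞ (fun z => Z z μ) V) :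
    ContDiffOn ℝ ∞ (fun z => gdot (G (y z)) (X z) (Z z)) V :=
  ContDiffOn.sum fun μ _ => ContDiffOn.sum fun ν _ =>
    (((hG.smooth μ ν).comp hy.smooth hy.mapsTo).mul (hX μ)).mul (hZ ν)

theorem pderiv_metric_comp (hx : x ∈ V) (a : Fin d) (μ ν : Fin 4) :
    pderiv a (fun z => G (y z) μ ν) x
      = ∑ ρ, G (y x) μ ρ * connForm G y a ρ ν x + ∑ ρ, G (y x) ρ ν * connForm G y a ρ μ x := by
  have hW := hy.mapsTo hx
  have hd : DifferentiableAt ℝ (fun w => G w μ ν) (y x) :=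
    ((hG.smooth μ ν).contDiffAt (hG.isOpen.mem_nhds hW)).differentiableAt (by simp)
  rw [pderiv_comp (f := fun w => G w μ ν) hd (hy.differentiableAt hx)]
  simp_rw [hG.pderiv_metric hW, add_mul, Finset.sum_add_distrib, connForm, Finset.mul_sum,
    Finset.sum_mul]
  congr 1 <;>
  · rw [Finset.sum_comm]
    exact Finset.sum_congr rfl fun _ _ => Finset.sum_congr rfl fun _ _ => by ring

/-- The connection is metric. -/
theorem pderiv_gdot (hx : x ∈ V) (a : Fin d) (hX : ∀ μ, ContDiffOn ℝ ∞ (fun z => X z μ) V)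
    (hZ : ∀ μ, ContDiffOn ℝ ∞ (fun z => Z z μ) V) :
    pderiv a (fun z => gdot (G (y z)) (X z) (Z z)) x
      = gdot (G (y x)) (covD G y a X x) (Z x) + gdot (G (y x)) (X x) (covD G y a Z x) := by
  have hGy : ∀ μ ν, ContDiffOn ℝ ∞ (fun z => G (y z) μ ν) V := fun μ ν =>
    (hG.smooth μ ν).comp hy.smooth hy.mapsTo
  have h1 : pderiv a (fun z => gdot (G (y z)) (X z) (Z z)) x = ∑ μ, ∑ ν,
      ((pderiv a (fun z => G (y z) μ ν) x) * X x μ * Z x ν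
        + G (y x) μ ν * pderiv a (fun z => X z μ) x * Z x ν
        + G (y x) μ ν * X x μ * pderiv a (fun z => Z z ν) x) := by
    unfold gdot
    rw [pderiv_sum fun μ _ => hy.diff (ContDiffOn.sum fun ν _ =>
      ((hGy μ ν).mul (hX μ)).mul (hZ ν)) hx]
    refine Finset.sum_congr rfl fun μ _ => ?_
    rw [pderiv_sum fun ν _ => hy.diff (((hGy μ ν).mul (hX μ)).mul (hZ ν)) hx]
    refine Finset.sum_congr rfl fun ν _ => ?_
    rw [pderiv_mul (hy.diff ((hGy μ ν).mul (hX μ)) hx) (hy.diff (hZ ν) hx),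
      pderiv_mul (hy.diff (hGy μ ν) hx) (hy.diff (hX μ) hx)]
    ring
  have h2 := sum_connection (G (y x)) (fun ρ ν => connForm G y a ρ ν x) (X x) (Z x)
  rw [h1]
  simp_rw [pderiv_metric_comp hG hy hx, Finset.sum_add_distrib]
  rw [h2]
  simp_rw [gdot, covD, mul_add, add_mul, Finset.sum_add_distrib]
  ring

/-- The connection is torsion-free. -/
theorem covD_tvec_comm (hx : x ∈ V) (a b : Fin d) (ρ : Fin 4) :
    covD G y a (tvec y b) x ρ = covD G y b (tvec y a) x ρ := by
  unfold covD
  congr 1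
  · exact pderiv_comm hy.isOpen (hy.smooth_apply ρ) hx a b
  · simp_rw [connForm, Finset.sum_mul]
    rw [Finset.sum_comm]
    refine Finset.sum_congr rfl fun α _ => Finset.sum_congr rfl fun β _ => ?_
    rw [hG.christoffel_symm (hy.mapsTo hx)]
    simp only [tvec]
    ring

theorem pderiv_connForm (hx : x ∈ V) (a b : Fin d) (ρ β : Fin 4) :
    pderiv a (connForm G y b ρ β) x
      = ∑ μ, ∑ ν, pderiv μ (christoffel G ρ ν β) (y x) * tvec y a x μ * tvec y b x ν
        + ∑ α, christoffel G ρ α β (y x) * pderiv a (fun z => tvec y b z α) x := by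
  have hc : ∀ α, ContDiffOn ℝ ∞ (fun z => christoffel G ρ α β (y z)) V := fun α =>
    (hG.smooth_christoffel ρ α β).comp hy.smooth hy.mapsTo
  have h1 : pderiv a (connForm G y b ρ β) x = ∑ α, (pderiv a (fun z => christoffel G ρ α β (y z)) x
      * tvec y b x α + christoffel G ρ α β (y x) * pderiv a (fun z => tvec y b z α) x) := by
    change pderiv a (fun z => ∑ α, christoffel G ρ α β (y z) * tvec y b z α) x = _
    rw [pderiv_sum fun α _ => hy.diff ((hc α).mul (hy.smooth_tvec b α)) hx]
    exact Finset.sum_congr rfl fun α _ =>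
      pderiv_mul (hy.diff (hc α) hx) (hy.diff (hy.smooth_tvec b α) hx)
  rw [h1, Finset.sum_add_distrib, Finset.sum_comm]
  congr 1
  refine Finset.sum_congr rfl fun α _ => ?_
  rw [pderiv_comp (((hG.smooth_christoffel ρ α β).contDiffAt
    (hG.isOpen.mem_nhds (hy.mapsTo hx))).differentiableAt (by simp)) (hy.differentiableAt hx),
    Finset.sum_mul]
  rfl

/-- The curvature `dA + A ∧ A` of the pulled-back connection is the pullback of the curvature. The
second derivatives of `y` are symmetric in `a, b` and drop out. -/
theorem curvature_connForm (hx : x ∈ V) (a b : Fin d) (ρ β : Fin 4) :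
    pderiv a (connForm G y b ρ β) x - pderiv b (connForm G y a ρ β) x
      + ∑ κ, (connForm G y a ρ κ x * connForm G y b κ β x
        - connForm G y b ρ κ x * connForm G y a κ β x)
      = ∑ μ, ∑ ν, riemannUp G ρ β μ ν (y x) * tvec y a x μ * tvec y b x ν := by
  have h3 : ∀ α, pderiv a (fun z => tvec y b z α) x = pderiv b (fun z => tvec y a z α) x :=
    fun α => pderiv_comm hy.isOpen (hy.smooth_apply α) hx a b
  have h4 : ∑ μ, ∑ ν, pderiv μ (christoffel G ρ ν β) (y x) * tvec y b x μ * tvec y a x ν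
      = ∑ μ, ∑ ν, pderiv ν (christoffel G ρ μ β) (y x) * tvec y a x μ * tvec y b x ν := by
    rw [Finset.sum_comm]
    exact Finset.sum_congr rfl fun _ _ => Finset.sum_congr rfl fun _ _ => by ring
  have h5 : ∀ a b : Fin d, ∀ κ, connForm G y a ρ κ x * connForm G y b κ β x
      = ∑ μ, ∑ ν, christoffel G ρ μ κ (y x) * christoffel G κ ν β (y x)
        * tvec y a x μ * tvec y b x ν := by
    intro a b κ
    rw [connForm, connForm, Finset.sum_mul_sum]
    exact Finset.sum_congr rfl fun _ _ => Finset.sum_congr rfl fun _ _ => by simp only [tvec]; ring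
  have h6 : ∀ κ, connForm G y b ρ κ x * connForm G y a κ β x
      = ∑ μ, ∑ ν, christoffel G ρ ν κ (y x) * christoffel G κ μ β (y x)
        * tvec y a x μ * tvec y b x ν := by
    intro κ
    rw [h5 b a, Finset.sum_comm]
    exact Finset.sum_congr rfl fun _ _ => Finset.sum_congr rfl fun _ _ => by ring
  have h7 : ∑ κ, (connForm G y a ρ κ x * connForm G y b κ β x
        - connForm G y b ρ κ x * connForm G y a κ β x)
      = ∑ μ, ∑ ν, (∑ κ, (christoffel G ρ μ κ (y x) * christoffel G κ ν β (y x)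
        - christoffel G ρ ν κ (y x) * christoffel G κ μ β (y x))) * tvec y a x μ * tvec y b x ν := by
    simp_rw [h6, h5 a b, ← Finset.sum_sub_distrib, Finset.sum_mul]
    rw [Finset.sum_comm]
    refine Finset.sum_congr rfl fun μ _ => ?_
    rw [Finset.sum_comm]
    exact Finset.sum_congr rfl fun _ _ => Finset.sum_congr rfl fun _ _ => by ring
  rw [pderiv_connForm hG hy hx, pderiv_connForm hG hy hx b a, h4, h7]
  simp_rw [h3, riemannUp, add_mul, sub_mul, Finset.sum_add_distrib, Finset.sum_sub_distrib]
  ring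

/-- The commutator of covariant derivatives is the Riemann tensor. -/
theorem covD_covD_sub (hx : x ∈ V) (a b : Fin d) (hX : ∀ μ, ContDiffOn ℝ ∞ (fun z => X z μ) V)
    (ρ : Fin 4) :
    covD G y a (covD G y b X) x ρ - covD G y b (covD G y a X) x ρ
      = ∑ β, ∑ μ, ∑ ν, riemannUp G ρ β μ ν (y x) * X x β * tvec y a x μ * tvec y b x ν := by
  have h1 : ∀ a b : Fin d, pderiv a (fun z => covD G y b X z ρ) x
      = pderiv a (pderiv b (fun z => X z ρ)) x + ∑ β, (pderiv a (connForm G y b ρ β) x * X x β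
        + connForm G y b ρ β x * pderiv a (fun z => X z β) x) := by
    intro a b
    unfold covD
    have hs : ∀ β, ContDiffOn ℝ ∞ (fun z => connForm G y b ρ β z * X z β) V := fun β =>
      (smooth_connForm hG hy b ρ β).mul (hX β)
    rw [pderiv_add (hy.diff ((hX ρ).pderiv hy.isOpen b) hx)
      (hy.diff (ContDiffOn.sum fun β _ => hs β) hx), pderiv_sum fun β _ => hy.diff (hs β) hx]
    congr 1
    exact Finset.sum_congr rfl fun β _ =>
      pderiv_mul (hy.diff (smooth_connForm hG hy b ρ β) hx) (hy.diff (hX β) hx)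
  have h2 : ∀ a b : Fin d, ∑ κ, connForm G y a ρ κ x * covD G y b X x κ
      = ∑ β, connForm G y a ρ β x * pderiv b (fun z => X z β) x
        + ∑ β, (∑ κ, connForm G y a ρ κ x * connForm G y b κ β x) * X x β := by
    intro a b
    simp_rw [covD, mul_add, Finset.sum_add_distrib, Finset.mul_sum, Finset.sum_mul]
    congr 1
    rw [Finset.sum_comm]
    exact Finset.sum_congr rfl fun _ _ => Finset.sum_congr rfl fun _ _ => by ring
  have h3 : ∀ a b : Fin d, covD G y a (covD G y b X) x ρ
      = pderiv a (fun z => covD G y b X z ρ) x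
        + ∑ κ, connForm G y a ρ κ x * covD G y b X x κ := fun a b => rfl
  have h4 : ∑ β, ∑ μ, ∑ ν, riemannUp G ρ β μ ν (y x) * X x β * tvec y a x μ * tvec y b x ν
      = ∑ β, (pderiv a (connForm G y b ρ β) x - pderiv b (connForm G y a ρ β) x
      + ∑ κ, (connForm G y a ρ κ x * connForm G y b κ β x
        - connForm G y b ρ κ x * connForm G y a κ β x)) * X x β := by
    refine Finset.sum_congr rfl fun β _ => ?_
    rw [curvature_connForm hG hy hx, Finset.sum_mul]
    refine Finset.sum_congr rfl fun _ _ => ?_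
    rw [Finset.sum_mul]
    exact Finset.sum_congr rfl fun _ _ => by ring
  -- The second derivatives of `X` and the cross terms (connection times `∂X`) are symmetric in `a,
  -- b`; only the curvature of `connForm` applied to `X` survives the commutator.
  rw [h3, h3, h1, h1, h2, h2, h4, pderiv_comm hy.isOpen (hX ρ) hx a b]
  simp_rw [add_mul, sub_mul, Finset.sum_add_distrib, Finset.sum_sub_distrib, sub_mul,
    Finset.sum_sub_distrib]
  ring

end

end Connection

/-! ## Algebra of the curvature tensor in an orthonormal frame -/

theorem _root_.Fintype.sum_comm_three {κ l m : Type*} [Fintype κ] [Fintype l] [Fintype m]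
    (T : κ → l → m → ℝ) : ∑ a, ∑ b, ∑ c, T a b c = ∑ b, ∑ c, ∑ a, T a b c := by
  rw [Finset.sum_comm]
  exact Finset.sum_congr rfl fun _ _ => Finset.sum_comm

section Algebra

variable {G : E4 → Matrix (Fin 4) (Fin 4) ℝ} {W : Set E4} {z : E4}

theorem sum_gInv_mul {H : E4 → Matrix (Fin 4) (Fin 4) ℝ} (h : (H z).det ≠ 0) (α σ : Fin 4) :
    ∑ ρ, gInv H z α ρ * H z ρ σ = if α = σ then 1 else 0 := by
  have := congrFun (congrFun (Matrix.nonsing_inv_mul (H z) h.isUnit) α) σ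
  rwa [Matrix.mul_apply, Matrix.one_apply] at this

/-- In dimension four the trace of the equations reads `R = 2R`, so `R = 0` and then the Ricci
tensor vanishes. -/
theorem ricci_eq_zero (hG : IsMetricOn G W) (hz : z ∈ W) (hE : ∀ μ ν, einstein G μ ν z = 0)
    (μ ν : Fin 4) : ricci G μ ν z = 0 := by
  have h1 : ∀ μ ν, ricci G μ ν z = (1 / 2) * scalarCurv G z * G z μ ν := fun μ ν =>
    sub_eq_zero.1 (hE μ ν)
  have h2 : scalarCurv G z = (1 / 2) * scalarCurv G z * 4 := by
    conv_lhs => rw [scalarCurv]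
    simp_rw [h1]
    have : ∀ μ, ∑ ν, gInv G z μ ν * (1 / 2 * scalarCurv G z * G z μ ν)
        = 1 / 2 * scalarCurv G z := by
      intro μ
      have := sum_gInv_mul (hG.det_ne z hz) μ μ
      rw [if_pos rfl] at this
      calc _ = 1 / 2 * scalarCurv G z * ∑ ν, gInv G z μ ν * G z ν μ := by
            rw [Finset.mul_sum]
            refine Finset.sum_congr rfl fun ν _ => ?_
            rw [hG.symm z hz μ ν]
            ring
        _ = _ := by rw [this, mul_one]
    simp_rw [this]
    simp
    ring
  have h3 : scalarCurv G z = 0 := by linarith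
  rw [h1, h3]
  ring

theorem weyl_eq_riemann (hR : ∀ μ ν, ricci G μ ν z = 0) (α β μ ν : Fin 4) :
    weyl G α β μ ν z = riemann G α β μ ν z := by
  have : scalarCurv G z = 0 := by simp [scalarCurv, hR]
  simp [weyl, hR, this]

/-- The value `R(u, v, w, q)` of the Riemann tensor. -/
def riemann4 (G : E4 → Matrix (Fin 4) (Fin 4) ℝ) (z : E4) (u v w q : Fin 4 → ℝ) : ℝ :=
  ∑ α, ∑ β, ∑ μ, ∑ ν, riemann G α β μ ν z * u α * v β * w μ * q ν

theorem gdot_riemannUp (G : E4 → Matrix (Fin 4) (Fin 4) ℝ) (z : E4) (hs : ∀ μ ν, G z μ ν = G z ν μ)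
    (u v w q : Fin 4 → ℝ) :
    gdot (G z) (fun ρ => ∑ β, ∑ μ, ∑ ν, riemannUp G ρ β μ ν z * v β * w μ * q ν) u
      = riemann4 G z u v w q := by
  rw [gdot_symm hs]
  unfold gdot riemann4 riemann
  refine Finset.sum_congr rfl fun α _ => ?_
  simp_rw [Finset.mul_sum, Finset.sum_mul]
  rw [Finset.sum_comm]
  refine Finset.sum_congr rfl fun β _ => ?_
  rw [Finset.sum_comm]
  refine Finset.sum_congr rfl fun μ _ => ?_
  rw [Finset.sum_comm]
  exact Finset.sum_congr rfl fun ν _ => Finset.sum_congr rfl fun ρ _ => by ring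

/-- The Riemann tensor is skew in its first pair of indices. -/
theorem riemann_antisymm (hG : IsMetricOn G W) (hz : z ∈ W) (α β μ ν : Fin 4) :
    riemann G α β μ ν z = - riemann G β α μ ν z := by
  -- Along the identity map `covD` is the spacetime connection itself; it is applied below to the
  -- constant coordinate fields `e a`.
  have hy : IsSmoothMapOn (d := 4) id W W := ⟨hG.isOpen, contDiffOn_id, fun _ h => h⟩
  have ht : ∀ a m : Fin 4, tvec (d := 4) id a z m = delta a m := fun a m => pderiv_apply
  set e : Fin 4 → E4 → Fin 4 → ℝ := fun a _ m => delta a m with he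
  have hes : ∀ a m, ContDiffOn ℝ ∞ (fun z => e a z m) W := fun a m => contDiffOn_const
  have hc := fun a b => smooth_covD hG hy a (hes b)
  have h2 : ∀ a b, pderiv a (pderiv b (fun w => gdot (G w) (e α w) (e β w))) z
      = gdot (G z) (covD G id a (covD G id b (e α)) z) (e β z)
        + gdot (G z) (covD G id b (e α) z) (covD G id a (e β) z)
        + (gdot (G z) (covD G id a (e α) z) (covD G id b (e β) z)
        + gdot (G z) (e α z) (covD G id a (covD G id b (e β)) z)) := by
    intro a b
    have : pderiv b (fun w => gdot (G w) (e α w) (e β w)) =ᶠ[nhds z] fun w =>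
        gdot (G (id w)) (covD G id b (e α) w) (e β w)
          + gdot (G (id w)) (e α w) (covD G id b (e β) w) := by
      filter_upwards [hG.isOpen.mem_nhds hz] with w hw
      exact pderiv_gdot hG hy hw b (hes α) (hes β)
    rw [pderiv_congr this, pderiv_add (hy.diff (smooth_gdot hG hy (hc b α) (hes β)) hz)
      (hy.diff (smooth_gdot hG hy (hes α) (hc b β)) hz),
      pderiv_gdot hG hy hz a (hc b α) (hes β), pderiv_gdot hG hy hz a (hes α) (hc b β)]
    rfl
  -- Second derivatives of the function `g(e_α, e_β)` commute. In their difference the products of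
  -- two first derivatives cancel, leaving `R_{βαμν} + R_{αβμν} = 0`.
  have h3 := pderiv_comm hG.isOpen (smooth_gdot hG hy (hes α) (hes β)) hz μ ν
  simp only [id] at h3
  rw [h2, h2] at h3
  have hsub : ∀ u v w : Fin 4 → ℝ, gdot (G z) (fun ρ => u ρ - v ρ) w
      = gdot (G z) u w - gdot (G z) v w := by
    intro u v w
    simp_rw [gdot, mul_sub, sub_mul, Finset.sum_sub_distrib]
  have h4 : ∀ a b, gdot (G z) (covD G id μ (covD G id ν (e a)) z) (e b z)
      - gdot (G z) (covD G id ν (covD G id μ (e a)) z) (e b z) = riemann G b a μ ν z := by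
    intro a b
    rw [← hsub]
    have : (fun ρ => covD G id μ (covD G id ν (e a)) z ρ - covD G id ν (covD G id μ (e a)) z ρ)
        = fun ρ => ∑ β, ∑ m, ∑ n, riemannUp G ρ β m n z * e a z β * tvec (d := 4) id μ z m
          * tvec (d := 4) id ν z n := by
      funext ρ
      exact covD_covD_sub hG hy hz μ ν (hes a) ρ
    rw [this, gdot_riemannUp G z (hG.symm z hz)]
    simp_rw [riemann4, ht, he, delta]
    simp
  have h5 := h4 α β
  have h6 := h4 β α
  rw [gdot_symm (hG.symm z hz) (e α z) (covD G id μ _ z),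
    gdot_symm (hG.symm z hz) (e α z) (covD G id ν _ z),
    gdot_symm (hG.symm z hz) (covD G id ν (e α) z), gdot_symm (hG.symm z hz) (covD G id μ (e α) z)]
    at h3
  have h7 := gdot_symm (hG.symm z hz) (covD G id ν (e β) z) (covD G id μ (e α) z)
  have h8 := gdot_symm (hG.symm z hz) (covD G id μ (e β) z) (covD G id ν (e α) z)
  linarith

theorem riemann4_self (hG : IsMetricOn G W) (hz : z ∈ W) (v w q : Fin 4 → ℝ) :
    riemann4 G z v v w q = 0 := by
  have : riemann4 G z v v w q = - riemann4 G z v v w q := by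
    conv_lhs => rw [riemann4, Finset.sum_comm]
    unfold riemann4
    simp_rw [← Finset.sum_neg_distrib]
    refine Finset.sum_congr rfl fun β _ => Finset.sum_congr rfl fun α _ =>
      Finset.sum_congr rfl fun μ _ => Finset.sum_congr rfl fun ν _ => ?_
    rw [riemann_antisymm hG hz α β]
    ring
  linarith

/-- `F` is an orthonormal frame for the symmetric bilinear form `H`, with timelike vector `F 0`. -/
def IsFrame (H : Matrix (Fin 4) (Fin 4) ℝ) (F : Fin 4 → Fin 4 → ℝ) : Prop :=
  ∀ a b, gdot H (F a) (F b) = if a = b then (if a = 0 then -1 else 1) else 0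

/-- The signs `(-1, 1, 1, 1)`. -/
def eta (a : Fin 4) : ℝ := if a = 0 then -1 else 1

theorem eta_mul_self (a : Fin 4) : eta a * eta a = 1 := by
  unfold eta; split_ifs <;> norm_num

namespace IsFrame

variable {H : Matrix (Fin 4) (Fin 4) ℝ} {F : Fin 4 → Fin 4 → ℝ}

theorem matrix_eq (hF : IsFrame H F) :
    Matrix.of F * H * (Matrix.of F).transpose = Matrix.diagonal eta := by
  ext a b
  have := hF a b
  rw [Matrix.diagonal_apply, eta, ← this, Matrix.mul_apply]
  simp_rw [Matrix.mul_apply, Finset.sum_mul]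
  rw [Finset.sum_comm]
  refine Finset.sum_congr rfl fun μ _ => Finset.sum_congr rfl fun ν _ => ?_
  simp only [Matrix.of_apply, Matrix.transpose_apply]
  ring

theorem det_eq (hF : IsFrame H F) : (Matrix.of F).det * H.det * (Matrix.of F).det = -1 := by
  have := congrArg Matrix.det hF.matrix_eq
  rw [Matrix.det_mul, Matrix.det_mul, Matrix.det_transpose, Matrix.det_diagonal] at this
  rw [this]
  simp [eta]

theorem transpose_mul (hF : IsFrame H F) :
    (Matrix.of F).transpose * Matrix.diagonal eta * Matrix.of F * H = 1 := by
  have hη : Matrix.diagonal eta * Matrix.diagonal eta = (1 : Matrix (Fin 4) (Fin 4) ℝ) := by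
    rw [Matrix.diagonal_mul_diagonal]
    simp_rw [eta_mul_self]
    exact Matrix.diagonal_one
  have h1 : Matrix.diagonal eta * (Matrix.of F * H) * (Matrix.of F).transpose = 1 := by
    rw [Matrix.mul_assoc, hF.matrix_eq, hη]
  -- A one-sided inverse of a square matrix is two-sided, so the last factor `Fᵀ` may be moved to
  -- the front.
  simpa only [Matrix.mul_assoc] using mul_eq_one_comm.1 h1

theorem inv_eq (hF : IsFrame H F) (μ ν : Fin 4) : H⁻¹ μ ν = ∑ a, eta a * F a μ * F a ν := by
  rw [Matrix.inv_eq_left_inv hF.transpose_mul, Matrix.mul_apply]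
  refine Finset.sum_congr rfl fun a _ => ?_
  rw [Matrix.mul_diagonal]
  simp only [Matrix.of_apply, Matrix.transpose_apply]
  ring

theorem expand (hF : IsFrame H F) (v : Fin 4 → ℝ) (μ : Fin 4) :
    v μ = ∑ a, eta a * gdot H (F a) v * F a μ := by
  have h1 := congrFun (congrArg (fun A => Matrix.mulVec A v) hF.transpose_mul) μ
  simp only [Matrix.one_mulVec, ← Matrix.mulVec_mulVec] at h1
  rw [← h1, Matrix.mulVec_eq_sum]
  simp only [Finset.sum_apply, Matrix.mulVec_diagonal]
  refine Finset.sum_congr rfl fun a _ => ?_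
  have : (Matrix.of F).mulVec (H.mulVec v) a = gdot H (F a) v := by
    change ∑ μ, F a μ * (∑ ν, H μ ν * v ν) = _
    simp_rw [gdot, Finset.mul_sum]
    exact Finset.sum_congr rfl fun μ _ => Finset.sum_congr rfl fun ν _ => by ring
  simp [this, mul_comm]

theorem gdot_eq (hF : IsFrame H F) (v w : Fin 4 → ℝ) :
    gdot H v w = ∑ a, eta a * gdot H (F a) v * gdot H (F a) w := by
  conv_lhs => rw [show v = fun μ => ∑ a, eta a * gdot H (F a) v * F a μ from
    funext (hF.expand v)]
  rw [gdot]
  simp_rw [Finset.mul_sum, Finset.sum_mul]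
  have : ∀ a, eta a * gdot H (F a) v * gdot H (F a) w
      = ∑ μ, ∑ ν, H μ ν * (eta a * gdot H (F a) v * F a μ) * w ν := by
    intro a
    conv_lhs => rw [gdot.eq_1 H (F a) w]
    simp_rw [Finset.mul_sum]
    exact Finset.sum_congr rfl fun _ _ => Finset.sum_congr rfl fun _ _ => by ring
  simp_rw [this]
  exact (Fintype.sum_comm_three _).symm

end IsFrame

/-- The Ricci tensor is the trace of the Riemann tensor over a frame. -/
theorem ricci_eq_sum_frame (hG : IsMetricOn G W) (hz : z ∈ W) {F : Fin 4 → Fin 4 → ℝ}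
    (hF : IsFrame (G z) F) (v w : Fin 4 → ℝ) :
    ∑ σ, ∑ ν, ricci G σ ν z * v σ * w ν = ∑ a, eta a * riemann4 G z (F a) v (F a) w := by
  have h1 : ∀ ρ σ μ ν, riemannUp G ρ σ μ ν z = ∑ α, gInv G z ρ α * riemann G α σ μ ν z := by
    intro ρ σ μ ν
    simp_rw [riemann, Finset.mul_sum]
    rw [Finset.sum_comm]
    simp_rw [← mul_assoc, ← Finset.sum_mul, sum_gInv_mul (hG.det_ne z hz)]
    simp
  have h2 : ∀ ρ α, gInv G z ρ α = ∑ a, eta a * F a ρ * F a α := hF.inv_eq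
  have h3 : ∑ a, eta a * riemann4 G z (F a) v (F a) w
      = ∑ α, ∑ σ, ∑ ρ, ∑ ν, gInv G z ρ α * riemann G α σ ρ ν z * v σ * w ν := by
    simp_rw [h2, riemann4, Finset.mul_sum, Finset.sum_mul]
    rw [Finset.sum_comm]
    refine Finset.sum_congr rfl fun α _ => ?_
    rw [Finset.sum_comm]
    refine Finset.sum_congr rfl fun σ _ => ?_
    rw [Finset.sum_comm]
    refine Finset.sum_congr rfl fun ρ _ => ?_
    rw [Finset.sum_comm]
    exact Finset.sum_congr rfl fun ν _ => Finset.sum_congr rfl fun a _ => by ring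
  rw [h3]
  conv_rhs => rw [Finset.sum_comm]
  simp_rw [ricci, h1, Finset.sum_mul]
  refine Finset.sum_congr rfl fun σ _ => ?_
  rw [Fintype.sum_comm_three, Finset.sum_comm]

theorem sum_comm_four {κ : Type*} [Fintype κ] (T : κ → κ → κ → κ → κ → κ → κ → κ → ℝ) :
    ∑ a, ∑ b, ∑ c, ∑ d, ∑ e, ∑ f, ∑ g, ∑ h, T a b c d e f g h
      = ∑ e, ∑ f, ∑ g, ∑ h, ∑ a, ∑ b, ∑ c, ∑ d, T a b c d e f g h := by
  have h1 : ∀ S : κ → κ → κ → κ → ℝ, ∑ a, ∑ b, ∑ c, ∑ d, S a b c d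
      = ∑ p : κ × κ × κ × κ, S p.1 p.2.1 p.2.2.1 p.2.2.2 := by
    intro S
    simp_rw [Fintype.sum_prod_type]
  simp_rw [h1]
  exact Finset.sum_comm

theorem updateRow_det (A : Matrix (Fin 4) (Fin 4) ℝ) (i : Fin 4) :
    A.det = ∑ ρ, A i ρ * (A.updateRow i (Pi.single ρ 1)).det := by
  rw [Matrix.det_eq_sum_mul_adjugate_row A i]
  simp_rw [Matrix.adjugate_apply]

/-- Multilinearity of the determinant, one row at a time; what remains is the determinant of four
basis vectors, which is the Levi-Civita symbol. -/
theorem det_rows_eq_sum (p q r s : Fin 4 → ℝ) :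
    (Matrix.of ![p, q, r, s]).det = ∑ ρ, ∑ σ, ∑ ν, ∑ β,
      leviCivita ![ρ, σ, ν, β] * p ρ * q σ * r ν * s β := by
  have h0 : ∀ p q r s : Fin 4 → ℝ, (Matrix.of ![p, q, r, s]).det
      = ∑ ρ, p ρ * (Matrix.of ![Pi.single ρ 1, q, r, s]).det := by
    intro p q r s
    rw [updateRow_det _ 0]
    refine Finset.sum_congr rfl fun ρ _ => ?_
    congr 2
    ext i j
    fin_cases i <;> simp [Matrix.updateRow_apply]
  have h1 : ∀ p q r s : Fin 4 → ℝ, (Matrix.of ![p, q, r, s]).det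
      = ∑ ρ, q ρ * (Matrix.of ![p, Pi.single ρ 1, r, s]).det := by
    intro p q r s
    rw [updateRow_det _ 1]
    refine Finset.sum_congr rfl fun ρ _ => ?_
    congr 2
    ext i j
    fin_cases i <;> simp [Matrix.updateRow_apply]
  have h2 : ∀ p q r s : Fin 4 → ℝ, (Matrix.of ![p, q, r, s]).det
      = ∑ ρ, r ρ * (Matrix.of ![p, q, Pi.single ρ 1, s]).det := by
    intro p q r s
    rw [updateRow_det _ 2]
    refine Finset.sum_congr rfl fun ρ _ => ?_
    congr 2
    ext i j
    fin_cases i <;> simp [Matrix.updateRow_apply]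
  have h3 : ∀ p q r s : Fin 4 → ℝ, (Matrix.of ![p, q, r, s]).det
      = ∑ ρ, s ρ * (Matrix.of ![p, q, r, Pi.single ρ 1]).det := by
    intro p q r s
    rw [updateRow_det _ 3]
    refine Finset.sum_congr rfl fun ρ _ => ?_
    congr 2
    ext i j
    fin_cases i <;> simp [Matrix.updateRow_apply]
  rw [h0]
  refine Finset.sum_congr rfl fun ρ _ => ?_
  rw [h1, Finset.mul_sum]
  refine Finset.sum_congr rfl fun σ _ => ?_
  rw [h2, Finset.mul_sum, Finset.mul_sum]
  refine Finset.sum_congr rfl fun ν _ => ?_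
  rw [h3, Finset.mul_sum, Finset.mul_sum, Finset.mul_sum]
  refine Finset.sum_congr rfl fun β _ => ?_
  have : leviCivita ![ρ, σ, ν, β] = (Matrix.of ![(Pi.single ρ 1 : Fin 4 → ℝ), Pi.single σ 1,
      Pi.single ν 1, Pi.single β 1]).det := by
    rw [leviCivita]
    congr 1
    ext i j
    fin_cases i <;> simp [Pi.single_apply, eq_comm]
  rw [this]
  ring

/-- The volume form on vectors of a positive orthonormal frame. -/
theorem volForm_frame {F : Fin 4 → Fin 4 → ℝ} (hF : IsFrame (G z) F) (a b c e : Fin 4) :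
    ∑ ρ, ∑ σ, ∑ ν, ∑ β, volForm G (Matrix.of F).transpose ρ σ ν β z * F a ρ * F b σ * F c ν * F e β
      = leviCivita ![a, b, c, e] := by
  set D := (Matrix.of F).det with hD
  -- Orthonormality gives `D² det G = -1`, so `√|det G| = 1/|D|`; the sign of `D` in `volForm` then
  -- makes the frame have volume `+1`.
  have h1 : Real.sign D * Real.sqrt |(G z).det| * D = 1 := by
    have h2 : D ^ 2 * (G z).det = -1 := by rw [← hF.det_eq]; ring
    have h3 : |D| * Real.sqrt |(G z).det| = 1 := by
      rw [← Real.sqrt_sq_eq_abs, ← Real.sqrt_mul (sq_nonneg D), ← abs_of_nonneg (sq_nonneg D),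
        ← abs_mul, h2]
      simp
    rw [← h3]
    have : Real.sign D * D = |D| := by
      rcases lt_trichotomy D 0 with h | h | h
      · rw [Real.sign_of_neg h, abs_of_neg h]; ring
      · simp [h]
      · rw [Real.sign_of_pos h, abs_of_pos h]; ring
    rw [← this]
    ring
  have h2 : (Matrix.of ![F a, F b, F c, F e]).det = leviCivita ![a, b, c, e] * D := by
    rw [leviCivita, hD, ← Matrix.det_mul]
    congr 1
    ext i j
    have key : ∀ a, F a j = ∑ l, (if a = l then (1 : ℝ) else 0) * F l j := by simp
    fin_cases i <;> exact key _
  calc _ = Real.sign D * Real.sqrt |(G z).det| * (Matrix.of ![F a, F b, F c, F e]).det := by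
        rw [det_rows_eq_sum]
        simp_rw [Finset.mul_sum, volForm, Matrix.det_transpose]
        refine Finset.sum_congr rfl fun _ _ => Finset.sum_congr rfl fun _ _ =>
          Finset.sum_congr rfl fun _ _ => Finset.sum_congr rfl fun _ _ => by ring
    _ = _ := by
        rw [h2, mul_left_comm, h1, mul_one]

/-- Over `ℤ` the symbol is computable, so identities between symbols can be settled by `decide`. -/
theorem leviCivita_eq_intCast {d : ℕ} (a : Fin d → Fin d) : leviCivita a
    = (((Matrix.of fun i j => (if a i = j then (1 : ℤ) else 0)).det : ℤ) : ℝ) := by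
  have := (Int.castRingHom ℝ).map_det (Matrix.of fun i j => if a i = j then (1 : ℤ) else 0)
  rw [leviCivita]
  refine Eq.trans ?_ this.symm
  congr 1
  ext i j
  simp

/-- No sign appears: moving `0` to the front past two indices is even, and so is the cyclic shift of
`a, b, j`. -/
theorem leviCivita_succ (a b j : Fin 3) :
    leviCivita ![a.succ, b.succ, 0, j.succ] = leviCivita ![j, a, b] := by
  rw [leviCivita_eq_intCast, leviCivita_eq_intCast]
  congr 1
  revert a b j
  decide +kernel

theorem leviCivita_zero_left (b j : Fin 4) : leviCivita ![0, b, 0, j] = 0 :=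
  Matrix.det_zero_of_row_eq (i := 0) (j := 2) (by decide) rfl

theorem leviCivita_zero_right (a j : Fin 4) : leviCivita ![a, 0, 0, j] = 0 :=
  Matrix.det_zero_of_row_eq (i := 1) (j := 2) (by decide) rfl

end Algebra

/-! ### The dual of the Weyl tensor in an orthonormal frame -/

section Magnetic

theorem leviCivita_swap (j a b : Fin 3) : leviCivita ![j, b, a] = - leviCivita ![j, a, b] := by
  rw [leviCivita_eq_intCast, leviCivita_eq_intCast, ← Int.cast_neg]
  congr 1
  revert a b j
  decide +kernel

variable {G : E4 → Matrix (Fin 4) (Fin 4) ℝ} {W : Set E4} {z : E4}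

theorem sum_comm_two_four {κ : Type*} [Fintype κ] (T : κ → κ → κ → κ → κ → κ → ℝ) :
    ∑ a, ∑ b, ∑ e, ∑ f, ∑ g, ∑ h, T a b e f g h
      = ∑ e, ∑ f, ∑ g, ∑ h, ∑ a, ∑ b, T a b e f g h := by
  have h1 : ∀ S : κ → κ → κ → κ → κ → ℝ, ∑ b, ∑ e, ∑ f, ∑ g, ∑ h, S b e f g h
      = ∑ e, ∑ f, ∑ g, ∑ h, ∑ b, S b e f g h := by
    intro S
    rw [Fintype.sum_comm_three]
    exact Finset.sum_congr rfl fun _ _ => Finset.sum_congr rfl fun _ _ =>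
      Fintype.sum_comm_three _
  simp_rw [h1 (T _)]
  exact h1 _

theorem sum_comm_two_two {κ : Type*} [Fintype κ] (T : κ → κ → κ → κ → ℝ) :
    ∑ a, ∑ b, ∑ e, ∑ f, T a b e f = ∑ e, ∑ f, ∑ a, ∑ b, T a b e f := by
  have h2 : ∀ S : κ → κ → ℝ, ∑ a, ∑ b, S a b = ∑ p : κ × κ, S p.1 p.2 := by
    intro S
    simp_rw [Fintype.sum_prod_type]
  simp_rw [h2]
  exact Finset.sum_comm

/-- The contraction of the dual Weyl tensor, expanded in an orthonormal frame. -/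
theorem weylDual_contract {F : Fin 4 → Fin 4 → ℝ} (hF : IsFrame (G z) F)
    (hR : ∀ μ ν, ricci G μ ν z = 0) (O : Matrix (Fin 4) (Fin 4) ℝ) (u v q w : Fin 4 → ℝ) :
    ∑ α, ∑ μ, ∑ ν, ∑ β, weylDual G O α μ ν β z * v μ * q ν * u α * w β
      = (1 / 2) * ∑ a, ∑ b, eta a * eta b * riemann4 G z u v (F a) (F b) *
        ∑ ρ, ∑ σ, ∑ ν, ∑ β, volForm G O ρ σ ν β z * F a ρ * F b σ * q ν * w β := by
  set C : Fin 4 → Fin 4 → ℝ := fun l d => ∑ α, ∑ μ, riemann G α μ l d z * u α * v μ with hC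
  set P : Fin 4 → Fin 4 → ℝ := fun ρ σ => ∑ ν, ∑ β, volForm G O ρ σ ν β z * q ν * w β with hP
  have h1 : ∑ α, ∑ μ, ∑ ν, ∑ β, weylDual G O α μ ν β z * v μ * q ν * u α * w β
      = ∑ l, ∑ d, ∑ ρ, ∑ σ, (1 / 2) * (gInv G z l ρ * gInv G z d σ * (C l d * P ρ σ)) := by
    simp_rw [weylDual, weyl_eq_riemann hR, Finset.mul_sum, Finset.sum_mul]
    rw [sum_comm_four]
    refine Finset.sum_congr rfl fun l _ => Finset.sum_congr rfl fun d _ =>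
      Finset.sum_congr rfl fun ρ _ => Finset.sum_congr rfl fun σ _ => ?_
    simp_rw [hC, hP, Finset.sum_mul, Finset.mul_sum]
    exact Finset.sum_congr rfl fun _ _ => Finset.sum_congr rfl fun _ _ =>
      Finset.sum_congr rfl fun _ _ => Finset.sum_congr rfl fun _ _ => by ring
  have h2 : ∀ a b, riemann4 G z u v (F a) (F b) = ∑ l, ∑ d, C l d * F a l * F b d := by
    intro a b
    simp_rw [riemann4, hC, Finset.sum_mul]
    have := sum_comm_two_two (fun α β μ ν => riemann G α β μ ν z * u α * v β * F a μ * F b ν)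
    exact this
  have h3 : ∀ a b, ∑ ρ, ∑ σ, ∑ ν, ∑ β, volForm G O ρ σ ν β z * F a ρ * F b σ * q ν * w β
      = ∑ ρ, ∑ σ, P ρ σ * F a ρ * F b σ := by
    intro a b
    simp_rw [hP, Finset.sum_mul]
    exact Finset.sum_congr rfl fun _ _ => Finset.sum_congr rfl fun _ _ =>
      Finset.sum_congr rfl fun _ _ => Finset.sum_congr rfl fun _ _ => by ring
  -- Both index-raising inverse metrics are resolved as `∑ η_a F_a F_a`, which turns the contraction
  -- over coordinate indices into one over frame vectors.
  have h4 : ∀ μ ν, gInv G z μ ν = ∑ a, eta a * F a μ * F a ν := hF.inv_eq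
  rw [h1]
  simp_rw [h2, h3, h4, Finset.sum_mul, Finset.mul_sum, Finset.sum_mul, Finset.mul_sum]
  rw [sum_comm_two_four, sum_comm_two_two]
  exact Finset.sum_congr rfl fun _ _ => Finset.sum_congr rfl fun _ _ =>
    Finset.sum_congr rfl fun _ _ => Finset.sum_congr rfl fun _ _ =>
      Finset.sum_congr rfl fun _ _ => Finset.sum_congr rfl fun _ _ => by ring

theorem sum_sum_fin_four {f : Fin 4 → Fin 4 → ℝ} (h0 : ∀ b, f 0 b = 0) (h1 : ∀ a, f a 0 = 0) :
    ∑ a, ∑ b, f a b = ∑ a : Fin 3, ∑ b : Fin 3, f a.succ b.succ := by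
  rw [Fin.sum_univ_succ, Finset.sum_eq_zero fun b _ => h0 b, zero_add]
  exact Finset.sum_congr rfl fun a _ => by rw [Fin.sum_univ_succ, h1, zero_add]

end Magnetic

/-! ## Flat slices in a coordinate system -/

/-- A flat spatial slice `y : V → W` with unit normal `N`, in spacetime coordinates. -/
structure IsFlatSliceIn (G : E4 → Matrix (Fin 4) (Fin 4) ℝ) (W : Set E4) (V : Set E3)
    (y : E3 → E4) (N : E3 → Fin 4 → ℝ) : Prop where
  metric : IsMetricOn G W
  map : IsSmoothMapOn y V W
  smooth : ∀ μ, ContDiffOn ℝ ∞ (fun x => N x μ) V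
  flat : ∀ x ∈ V, ∀ i j, gdot (G (y x)) (tvec y i x) (tvec y j x) = delta i j
  unit : ∀ x ∈ V, gdot (G (y x)) (N x) (N x) = -1
  normal : ∀ x ∈ V, ∀ i, gdot (G (y x)) (N x) (tvec y i x) = 0

/-- The extrinsic curvature in a coordinate system. -/
def extrinsicIn (G : E4 → Matrix (Fin 4) (Fin 4) ℝ) (y : E3 → E4) (N : E3 → Fin 4 → ℝ)
    (i j : Fin 3) (x : E3) : ℝ :=
  - gdot (G (y x)) (covD G y i N x) (tvec y j x)

/-- The frame `(N, ∂_1 y, ∂_2 y, ∂_3 y)`. -/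
def sliceFrame (y : E3 → E4) (N : E3 → Fin 4 → ℝ) (x : E3) : Fin 4 → Fin 4 → ℝ :=
  Fin.cons (N x) fun i => tvec y i x

namespace IsFlatSliceIn

variable {G : E4 → Matrix (Fin 4) (Fin 4) ℝ} {W : Set E4} {V : Set E3} {y : E3 → E4}
  {N : E3 → Fin 4 → ℝ} {x : E3} (h : IsFlatSliceIn G W V y N) (hx : x ∈ V)
include h

theorem smooth_extrinsicIn (i j : Fin 3) : ContDiffOn ℝ ∞ (extrinsicIn G y N i j) V :=
  (smooth_gdot h.metric h.map (smooth_covD h.metric h.map i h.smooth) (h.map.smooth_tvec j)).neg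

include hx

theorem symm_at (μ ν : Fin 4) : G (y x) μ ν = G (y x) ν μ :=
  h.metric.symm _ (h.map.mapsTo hx) μ ν

theorem isFrame : IsFrame (G (y x)) (sliceFrame y N x) := by
  intro a b
  refine Fin.cases ?_ (fun i => ?_) a <;> refine Fin.cases ?_ (fun j => ?_) b
  · simpa [sliceFrame] using h.unit x hx
  · simpa [sliceFrame, Fin.succ_ne_zero, eq_comm] using h.normal x hx j
  · rw [gdot_symm (h.symm_at hx)]
    simpa [sliceFrame, Fin.succ_ne_zero] using h.normal x hx i
  · simpa [sliceFrame, delta] using h.flat x hx i j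

/-- The induced connection of a flat slice vanishes. -/
theorem gdot_covD_tvec (a b c : Fin 3) :
    gdot (G (y x)) (covD G y a (tvec y b) x) (tvec y c x) = 0 := by
  have h1 : ∀ a b c : Fin 3, gdot (G (y x)) (covD G y a (tvec y b) x) (tvec y c x)
      = gdot (G (y x)) (covD G y b (tvec y a) x) (tvec y c x) := by
    intro a b c
    rw [show covD G y a (tvec y b) x = covD G y b (tvec y a) x from
      funext (covD_tvec_comm h.metric h.map hx a b)]
  have h2 : ∀ a b c : Fin 3, gdot (G (y x)) (covD G y a (tvec y b) x) (tvec y c x)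
      + gdot (G (y x)) (covD G y a (tvec y c) x) (tvec y b x) = 0 := by
    intro a b c
    have := pderiv_gdot h.metric h.map hx a (h.map.smooth_tvec b) (h.map.smooth_tvec c)
    rw [gdot_symm (h.symm_at hx) (tvec y b x), pderiv_congr (h := fun _ => delta b c) (by
      filter_upwards [h.map.isOpen.mem_nhds hx] with w hw using h.flat w hw b c),
      pderiv_const] at this
    exact this.symm
  -- The Koszul argument: an array symmetric in its first two indices and skew in its last two is
  -- zero.
  linarith [h2 a b c, h2 c a b, h2 b c a, h1 a b c, h1 a c b, h1 b c a]

theorem gdot_covD_normal (a : Fin 3) : gdot (G (y x)) (covD G y a N x) (N x) = 0 := by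
  have := pderiv_gdot h.metric h.map hx a h.smooth h.smooth
  rw [gdot_symm (h.symm_at hx) (N x), pderiv_congr (h := fun _ => -1) (by
      filter_upwards [h.map.isOpen.mem_nhds hx] with w hw using h.unit w hw), pderiv_const] at this
  linarith

/-- Differentiating `g(N, ∂_b) = 0` moves the derivative onto `∂_b`. In this form the symmetry of
`K` is the absence of torsion. -/
theorem extrinsicIn_eq (a b : Fin 3) :
    extrinsicIn G y N a b x = gdot (G (y x)) (N x) (covD G y a (tvec y b) x) := by
  have := pderiv_gdot h.metric h.map hx a h.smooth (h.map.smooth_tvec b)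
  rw [pderiv_congr (h := fun _ => 0) (by
      filter_upwards [h.map.isOpen.mem_nhds hx] with w hw using h.normal w hw b),
      pderiv_const] at this
  rw [extrinsicIn]
  linarith

theorem extrinsicIn_symm (a b : Fin 3) :
    extrinsicIn G y N a b x = extrinsicIn G y N b a x := by
  rw [h.extrinsicIn_eq hx, h.extrinsicIn_eq hx, show covD G y a (tvec y b) x
    = covD G y b (tvec y a) x from funext (covD_tvec_comm h.metric h.map hx a b)]

/-- The Codazzi equation. -/
theorem codazzi (a b i : Fin 3) :
    riemann4 G (y x) (tvec y i x) (N x) (tvec y a x) (tvec y b x)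
      = - pderiv a (extrinsicIn G y N b i) x + pderiv b (extrinsicIn G y N a i) x := by
  have h1 : ∀ a b, pderiv a (extrinsicIn G y N b i) x
      = - gdot (G (y x)) (covD G y a (covD G y b N) x) (tvec y i x) := by
    intro a b
    -- `∇_b N` is tangent because `N` has constant length, and `∇_a ∂_i` is normal because the slice
    -- is flat, so they are orthogonal. This is why only partial derivatives of `K` occur.
    have h2 : gdot (G (y x)) (covD G y b N x) (covD G y a (tvec y i) x) = 0 := by
      rw [(h.isFrame hx).gdot_eq, Fin.sum_univ_succ]
      simp_rw [sliceFrame, Fin.cons_zero, Fin.cons_succ]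
      rw [gdot_symm (h.symm_at hx) (N x), h.gdot_covD_normal hx]
      simp_rw [gdot_symm (h.symm_at hx) (tvec y _ x) (covD G y a (tvec y i) x),
        h.gdot_covD_tvec hx]
      simp
    change pderiv a (fun z => - gdot (G (y z)) (covD G y b N z) (tvec y i z)) x = _
    rw [pderiv_neg, pderiv_gdot h.metric h.map hx a (smooth_covD h.metric h.map b h.smooth)
      (h.map.smooth_tvec i), h2, add_zero]
  rw [h1, h1, ← gdot_riemannUp G (y x) (h.symm_at hx)]
  have : (fun ρ => ∑ β, ∑ μ, ∑ ν, riemannUp G ρ β μ ν (y x) * N x β * tvec y a x μ * tvec y b x ν)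
      = fun ρ => covD G y a (covD G y b N) x ρ - covD G y b (covD G y a N) x ρ := by
    funext ρ
    exact (covD_covD_sub h.metric h.map hx a b h.smooth ρ).symm
  rw [this]
  simp_rw [gdot, mul_sub, sub_mul, Finset.sum_sub_distrib]
  ring

variable (hE : ∀ μ ν, einstein G μ ν (y x) = 0)
include hE

/-- The momentum constraint. -/
theorem momentum_constraint (b : Fin 3) :
    ∑ i, pderiv i (extrinsicIn G y N b i) x = ∑ i, pderiv b (extrinsicIn G y N i i) x := by
  have hW := h.map.mapsTo hx
  -- The constraint is `Ric(N, ∂_b) = 0` written as a trace over the frame: the timelike term is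
  -- `R(N, N, ·, ·) = 0` and the spatial ones are given by Codazzi.
  have h1 := ricci_eq_sum_frame h.metric hW (h.isFrame hx) (N x) (tvec y b x)
  simp only [ricci_eq_zero h.metric hW hE, zero_mul, Finset.sum_const_zero] at h1
  rw [Fin.sum_univ_succ] at h1
  simp_rw [sliceFrame, Fin.cons_zero, Fin.cons_succ, riemann4_self h.metric hW,
    h.codazzi hx, eta] at h1
  simp [Finset.sum_add_distrib] at h1
  linarith

/-- The magnetic part of the Weyl tensor is the curl of the extrinsic curvature. -/
theorem magnetic_eq (i j : Fin 3) :
    ∑ α, ∑ μ, ∑ ν, ∑ β, weylDual G (Matrix.of (sliceFrame y N x)).transpose α μ ν β (y x)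
      * N x μ * N x ν * tvec y i x α * tvec y j x β
      = - ∑ a, ∑ b, leviCivita ![j, a, b] * pderiv a (extrinsicIn G y N b i) x := by
  have hW := h.map.mapsTo hx
  have hF := h.isFrame hx
  rw [weylDual_contract hF (ricci_eq_zero h.metric hW hE)]
  have h1 : ∀ a b, ∑ ρ, ∑ σ, ∑ ν, ∑ β, volForm G (Matrix.of (sliceFrame y N x)).transpose ρ σ ν β
      (y x) * sliceFrame y N x a ρ * sliceFrame y N x b σ * N x ν * tvec y j x β
      = leviCivita ![a, b, 0, j.succ] := fun a b => volForm_frame hF a b 0 j.succ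
  simp_rw [h1]
  -- The third slot of the symbol already holds the normal, so a frame index `0` among `a, b`
  -- contributes nothing.
  rw [sum_sum_fin_four (fun b => by rw [leviCivita_zero_left, mul_zero])
    (fun a => by rw [leviCivita_zero_right, mul_zero])]
  simp_rw [leviCivita_succ]
  -- The two halves of the Codazzi expression contribute equally, which absorbs the factor `1/2` in
  -- the dual.
  have h3 : ∑ a, ∑ b, leviCivita ![j, a, b] * pderiv b (extrinsicIn G y N a i) x
      = - ∑ a, ∑ b, leviCivita ![j, a, b] * pderiv a (extrinsicIn G y N b i) x := by
    rw [Finset.sum_comm]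
    simp_rw [← Finset.sum_neg_distrib]
    exact Finset.sum_congr rfl fun a _ => Finset.sum_congr rfl fun b _ => by
      rw [leviCivita_swap j b a]; ring
  have h4 : ∀ a b : Fin 3, eta a.succ * eta b.succ * riemann4 G (y x) (tvec y i x) (N x)
      (sliceFrame y N x a.succ) (sliceFrame y N x b.succ) * leviCivita ![j, a, b]
      = leviCivita ![j, a, b] * pderiv b (extrinsicIn G y N a i) x
        - leviCivita ![j, a, b] * pderiv a (extrinsicIn G y N b i) x := by
    intro a b
    simp only [sliceFrame, Fin.cons_succ, h.codazzi hx, eta, Fin.succ_ne_zero, if_false]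
    ring
  simp_rw [h4, Finset.sum_sub_distrib, h3]
  simp
  ring

end IsFlatSliceIn

/-! ## Independence of the coordinate system -/

section Transition

variable {G : E4 → Matrix (Fin 4) (Fin 4) ℝ} {W : Set E4} {V : Set E3} {y : E3 → E4}

/-- The right side is the first variation of the induced metric when `y` moves to `y + sN`. It
contains no Christoffel symbols, so a change of coordinates can be handled without their
transformation law. -/
theorem IsFlatSliceIn.extrinsicIn_eq_lie {N : E3 → Fin 4 → ℝ} {x : E3}
    (h : IsFlatSliceIn G W V y N) (hx : x ∈ V) (i j : Fin 3) :
    -2 * extrinsicIn G y N i j x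
      = ∑ μ, ∑ ν, (∑ l, pderiv l (fun z => G z μ ν) (y x) * N x l) * tvec y i x μ * tvec y j x ν
        + gdot (G (y x)) (fun μ => pderiv i (fun z => N z μ) x) (tvec y j x)
        + gdot (G (y x)) (tvec y i x) (fun μ => pderiv j (fun z => N z μ) x) := by
  have hW := h.map.mapsTo hx
  -- `A` is the Christoffel symbol contracted with the normal; by symmetry in the lower indices, `A`
  -- applied to `∂_i y` is also the connection term of `∇_i N`.
  set A : Matrix (Fin 4) (Fin 4) ℝ := fun ρ β => ∑ l, christoffel G ρ l β (y x) * N x l with hA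
  have h1 : ∀ μ ν, ∑ l, pderiv l (fun z => G z μ ν) (y x) * N x l
      = ∑ ρ, G (y x) μ ρ * A ρ ν + ∑ ρ, G (y x) ρ ν * A ρ μ := by
    intro μ ν
    simp_rw [h.metric.pderiv_metric hW, hA, add_mul, Finset.sum_add_distrib, Finset.mul_sum,
      Finset.sum_mul]
    congr 1 <;>
    · rw [Finset.sum_comm]
      exact Finset.sum_congr rfl fun _ _ => Finset.sum_congr rfl fun _ _ => by ring
  have h2 : ∀ i, covD G y i N x
      = fun ρ => pderiv i (fun z => N z ρ) x + ∑ β, A ρ β * tvec y i x β := by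
    intro i
    funext ρ
    rw [covD]
    congr 1
    simp_rw [hA, connForm, Finset.sum_mul]
    rw [Finset.sum_comm]
    refine Finset.sum_congr rfl fun _ _ => Finset.sum_congr rfl fun _ _ => ?_
    rw [h.metric.christoffel_symm hW]
    simp only [tvec]
    ring
  have h3 : -2 * extrinsicIn G y N i j x
      = gdot (G (y x)) (covD G y i N x) (tvec y j x)
        + gdot (G (y x)) (tvec y i x) (covD G y j N x) := by
    have := h.extrinsicIn_symm hx i j
    rw [gdot_symm (h.symm_at hx) (tvec y i x)]
    rw [extrinsicIn, extrinsicIn] at *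
    linarith
  simp_rw [h1]
  rw [h3, sum_connection, h2, h2]
  simp_rw [gdot, mul_add, add_mul, Finset.sum_add_distrib]
  ring

/-- With `P = y + sN` and `u, w` the varied tangent vectors, the derivative at `s = 0` is the right
side of `extrinsicIn_eq_lie`. -/
theorem hasDerivAt_gdot {P u w : ℝ → E4} {p' u' w' : E4} {s : ℝ}
    (hG : ∀ μ ν, DifferentiableAt ℝ (fun z => G z μ ν) (P s))
    (hP : HasDerivAt P p' s) (hu : HasDerivAt u u' s) (hw : HasDerivAt w w' s) :
    HasDerivAt (fun r => gdot (G (P r)) (u r).ofLp (w r).ofLp)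
      (∑ μ, ∑ ν, (∑ l, pderiv l (fun z => G z μ ν) (P s) * p' l) * u s μ * w s ν
        + gdot (G (P s)) u'.ofLp (w s).ofLp + gdot (G (P s)) (u s).ofLp w'.ofLp) s := by
  have hc : ∀ {v : ℝ → E4} {v' : E4}, HasDerivAt v v' s → ∀ μ, HasDerivAt (fun r => v r μ) (v' μ) s :=
    fun hv μ => (EuclideanSpace.proj μ : E4 →L[ℝ] ℝ).hasFDerivAt.comp_hasDerivAt s hv
  have h1 : ∀ μ ν, HasDerivAt (fun r => G (P r) μ ν)
      (∑ l, pderiv l (fun z => G z μ ν) (P s) * p' l) s := by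
    intro μ ν
    rw [← fderiv_eq_sum_pderiv]
    exact (hG μ ν).hasFDerivAt.comp_hasDerivAt s hP
  have h2 := HasDerivAt.fun_sum (u := Finset.univ) fun μ _ =>
    HasDerivAt.fun_sum (u := Finset.univ) fun ν _ => ((h1 μ ν).mul (hc hu μ)).mul (hc hw ν)
  refine h2.congr_deriv ?_
  simp_rw [gdot, ← Finset.sum_add_distrib]
  exact Finset.sum_congr rfl fun _ _ => Finset.sum_congr rfl fun _ _ => by
    simp only [Pi.mul_apply]; ring

/-- The extrinsic curvature does not depend on the coordinate system of spacetime. -/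
theorem extrinsicIn_transition {G' : E4 → Matrix (Fin 4) (Fin 4) ℝ} {W' O : Set E4} {V' : Set E3}
    {y' : E3 → E4} {N N' : E3 → E4} {x : E3} (h : IsFlatSliceIn G W V y fun z => (N z).ofLp)
    (h' : IsFlatSliceIn G' W' V' y' fun z => (N' z).ofLp) (hx : x ∈ V) (hx' : x ∈ V')
    {τ : E4 → E4} (hO : IsOpen O) (hτ : ContDiffOn ℝ ∞ τ O) (hxO : y x ∈ O)
    (hy : ∀ᶠ z in nhds x, y' z = τ (y z))
    (hN : ∀ᶠ z in nhds x, N' z = fderiv ℝ τ (y z) (N z))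
    (hGG : ∀ z ∈ O, ∀ v w : E4, gdot (G z) v.ofLp w.ofLp
      = gdot (G' (τ z)) (fderiv ℝ τ z v).ofLp (fderiv ℝ τ z w).ofLp) (i j : Fin 3) :
    extrinsicIn G y (fun z => (N z).ofLp) i j x
      = extrinsicIn G' y' (fun z => (N' z).ofLp) i j x := by
  have hNs : ∀ {N : E3 → E4} {V : Set E3}, IsOpen V → x ∈ V →
      (∀ μ, ContDiffOn ℝ ∞ (fun z => N z μ) V) → DifferentiableAt ℝ N x := by
    intro N V hV hx hN
    exact ((contDiffOn_euclidean.2 hN).contDiffAt (hV.mem_nhds hx)).differentiableAt (by simp)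
  have hNd := hNs h.map.isOpen hx h.smooth
  have hNd' := hNs h'.map.isOpen hx' h'.smooth
  have hyd := h.map.differentiableAt hx
  have hτ2 : ContDiffAt ℝ ∞ τ (y x) := hτ.contDiffAt (hO.mem_nhds hxO)
  have hτd : DifferentiableAt ℝ τ (y x) := hτ2.differentiableAt (by simp)
  have hτdd : DifferentiableAt ℝ (fderiv ℝ τ) (y x) :=
    (hτ2.fderiv_right (m := ∞) le_rfl).differentiableAt (by simp)
  have hsym : IsSymmSndFDerivAt ℝ τ (y x) :=
    hτ2.isSymmSndFDerivAt (by simpa using ENat.LEInfty.out)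
  set t : Fin 3 → E4 := fun a => fderiv ℝ y x (EuclideanSpace.single a 1) with ht
  set dN : Fin 3 → E4 := fun a => fderiv ℝ N x (EuclideanSpace.single a 1) with hdN
  have ht' : ∀ a, fderiv ℝ y' x (EuclideanSpace.single a 1) = fderiv ℝ τ (y x) (t a) := by
    intro a
    have hc : HasFDerivAt (fun z => τ (y z)) _ x := hτd.hasFDerivAt.comp x hyd.hasFDerivAt
    rw [Filter.EventuallyEq.fderiv_eq hy, hc.fderiv]
    rfl
  -- Symmetry of the second derivative of `τ` makes `∂_a N'` equal to the velocity, computed in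
  -- `hu`, of the pushed-forward vector `t a + s • dN a`.
  have hdN' : ∀ a, fderiv ℝ N' x (EuclideanSpace.single a 1)
      = fderiv ℝ (fderiv ℝ τ) (y x) (N x) (t a) + fderiv ℝ τ (y x) (dN a) := by
    intro a
    have hc : HasFDerivAt (fun z => fderiv ℝ τ (y z) (N z)) _ x :=
      (hτdd.hasFDerivAt.comp x hyd.hasFDerivAt).clm_apply hNd.hasFDerivAt
    rw [Filter.EventuallyEq.fderiv_eq hN, hc.fderiv, hsym.eq]
    simp [ht, hdN, add_comm]
  have hline : ∀ v v' : E4, HasDerivAt (fun s : ℝ => v + s • v') v' 0 := by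
    intro v v'
    simpa using ((hasDerivAt_id (0 : ℝ)).smul_const v').const_add v
  -- A straight line in the first coordinates and its image under `τ` carry the two variations that
  -- are compared.
  have hP := hline (y x) (N x)
  have hpt : y x + (0 : ℝ) • N x = y x := by simp
  have hP' : HasDerivAt (fun s : ℝ => τ (y x + s • N x)) (fderiv ℝ τ (y x) (N x)) 0 :=
    HasFDerivAt.comp_hasDerivAt_of_eq 0 hτd.hasFDerivAt hP (by simp)
  have hDτ : HasDerivAt (fun s : ℝ => fderiv ℝ τ (y x + s • N x))
      (fderiv ℝ (fderiv ℝ τ) (y x) (N x)) 0 :=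
    HasFDerivAt.comp_hasDerivAt_of_eq 0 hτdd.hasFDerivAt hP (by simp)
  have hu : ∀ a, HasDerivAt (fun s : ℝ => fderiv ℝ τ (y x + s • N x) (t a + s • dN a))
      (fderiv ℝ (fderiv ℝ τ) (y x) (N x) (t a) + fderiv ℝ τ (y x) (dN a)) 0 := by
    intro a
    simpa using hDτ.clm_apply (hline (t a) (dN a))
  have d1 := hasDerivAt_gdot (G := G) (s := 0) (by
    intro μ ν
    rw [hpt]
    exact ((h.metric.smooth μ ν).contDiffAt (h.metric.isOpen.mem_nhds
      (h.map.mapsTo hx))).differentiableAt (by simp)) hP (hline (t i) (dN i)) (hline (t j) (dN j))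
  have d2 := hasDerivAt_gdot (G := G') (s := 0) (by
    intro μ ν
    rw [hpt, ← hy.self_of_nhds]
    exact ((h'.metric.smooth μ ν).contDiffAt (h'.metric.isOpen.mem_nhds
      (h'.map.mapsTo hx'))).differentiableAt (by simp)) hP' (hu i) (hu j)
  -- While the line stays in `O`, `τ` is an isometry, so both variations are derivatives of the same
  -- function of `s`.
  have d3 := d2.congr_of_eventuallyEq (f₁ := fun s : ℝ =>
      gdot (G (y x + s • N x)) (t i + s • dN i).ofLp (t j + s • dN j).ofLp) (by
    have : ∀ᶠ s : ℝ in nhds 0, y x + s • N x ∈ O := by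
      refine hP.continuousAt.eventually_mem ?_
      rw [hpt]
      exact hO.mem_nhds hxO
    filter_upwards [this] with s hs using hGG _ hs _ _)
  have key := d1.unique d3
  have e1 := h.extrinsicIn_eq_lie hx i j
  have e2 := h'.extrinsicIn_eq_lie hx' i j
  have c1 : ∀ a, tvec y a x = (t a).ofLp := fun a => funext fun μ => pderiv_component hyd
  have c2 : ∀ a, (fun μ => pderiv a (fun z => N z μ) x) = (dN a).ofLp := fun a =>
    funext fun μ => pderiv_component hNd
  have c3 : ∀ a, tvec y' a x = (fderiv ℝ τ (y x) (t a)).ofLp := fun a => funext fun μ => by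
    rw [← ht', tvec, pderiv_component (h'.map.differentiableAt hx')]
  have c4 : ∀ a, (fun μ => pderiv a (fun z => N' z μ) x) = (fderiv ℝ (fderiv ℝ τ) (y x) (N x) (t a)
      + fderiv ℝ τ (y x) (dN a)).ofLp := fun a =>
    funext fun μ => by rw [← hdN', pderiv_component hNd']
  rw [c1, c1, c2, c2] at e1
  rw [c3, c3, c4, c4, hy.self_of_nhds, hN.self_of_nhds] at e2
  simp only [zero_smul, add_zero] at key
  linarith

end Transition

/-! ## Flat slices in the charts of spacetime -/

section Charts

variable {M : Type*} [TopologicalSpace M] [ChartedSpace E4 M]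

/-- The vector of components of `v ∈ T_q M` in the preferred chart around `p₀`. -/
def chartVec (p₀ q : M) (v : TangentSpace (𝓡 4) q) : E4 :=
  mfderiv (𝓡 4) (𝓡 4) (chartAt E4 p₀) q v

theorem chartVec_apply (p₀ q : M) (v : TangentSpace (𝓡 4) q) (μ : Fin 4) :
    chartVec p₀ q v μ = vecComp p₀ q v μ := rfl

variable [IsManifold (𝓡 4) ∞ M]

theorem mdifferentiableAt_chart {p₀ q : M} (hq : q ∈ (chartAt E4 p₀).source) :
    MDifferentiableAt (𝓡 4) (𝓡 4) (chartAt E4 p₀) q :=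
  (mdifferentiable_chart p₀).mdifferentiableAt hq

variable (g : LorentzMetric M)

theorem val_symm_eq (p₀ : M) {z : E4} (hz : z ∈ (chartAt E4 p₀).target)
    (v w : TangentSpace (𝓡 4) ((chartAt E4 p₀).symm z)) :
    g.val _ v w = gdot (g.comp p₀ z) (vecComp p₀ _ v) (vecComp p₀ _ w) := by
  set A : E4 →L[ℝ] E4 := mfderiv (𝓡 4) (𝓡 4) (chartAt E4 p₀) ((chartAt E4 p₀).symm z) with hA
  set B : E4 →L[ℝ] E4 := mfderiv (𝓡 4) (𝓡 4) (chartAt E4 p₀).symm z with hB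
  have h1 : A.comp B = ContinuousLinearMap.id ℝ E4 := (mdifferentiable_chart p₀).comp_symm_deriv hz
  have h2 : (A : E4 →ₗ[ℝ] E4) * (B : E4 →ₗ[ℝ] E4) = 1 := by
    ext1 u
    exact congrArg (fun L : E4 →L[ℝ] E4 => L u) h1
  -- In finite dimension a right inverse of the chart's differential is also a left inverse, so the
  -- coordinate vectors `B e_μ` span the tangent space.
  have h3 : (B : E4 →ₗ[ℝ] E4) * (A : E4 →ₗ[ℝ] E4) = 1 := mul_eq_one_comm.1 h2
  have h4 : ∀ u : E4, B (A u) = u := fun u => congrArg (fun L : E4 →ₗ[ℝ] E4 => L u) h3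
  have h5 : ∀ u : E4, u = ∑ μ, (A u) μ • B (EuclideanSpace.single μ (1 : ℝ)) := by
    intro u
    conv_lhs => rw [← h4 u, show A u = ∑ μ, (A u) μ • EuclideanSpace.single μ (1 : ℝ) by
      ext j; simp [Pi.single_apply]]
    simp only [map_sum, map_smul]
  have h6 : ∀ L : E4 →L[ℝ] E4 →L[ℝ] ℝ, ∀ v w : E4, L v w
      = ∑ μ, ∑ ν, L (B (EuclideanSpace.single μ (1 : ℝ))) (B (EuclideanSpace.single ν (1 : ℝ)))
        * (A v) μ * (A w) ν := by
    intro L v w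
    conv_lhs => rw [h5 v, h5 w]
    simp only [map_sum, map_smul, sum_apply, smul_apply,
      smul_eq_mul, Finset.mul_sum]
    rw [Finset.sum_comm]
    exact Finset.sum_congr rfl fun _ _ => Finset.sum_congr rfl fun _ _ => by ring
  exact h6 (g.val ((chartAt E4 p₀).symm z)) v w

theorem val_eq (p₀ : M) {q : M} (hq : q ∈ (chartAt E4 p₀).source) (v w : TangentSpace (𝓡 4) q) :
    g.val q v w = gdot (g.comp p₀ (chartAt E4 p₀ q)) (vecComp p₀ q v) (vecComp p₀ q w) := by
  obtain ⟨z, hz, rfl⟩ : ∃ z ∈ (chartAt E4 p₀).target, (chartAt E4 p₀).symm z = q :=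
    ⟨_, (chartAt E4 p₀).map_source hq, (chartAt E4 p₀).left_inv hq⟩
  rw [(chartAt E4 p₀).right_inv hz]
  exact val_symm_eq g p₀ hz v w

theorem isMetricOn_comp (p₀ : M) : IsMetricOn (g.comp p₀) (chartAt E4 p₀).target where
  isOpen := (chartAt E4 p₀).open_target
  smooth := g.smooth p₀
  symm z _ μ ν := g.symm _ _ _
  det_ne z hz h0 := by
    obtain ⟨b, hb⟩ := g.signature ((chartAt E4 p₀).symm z)
    -- The components of an orthonormal basis form a frame, and `(det F)² det G = -1` excludes a
    -- zero determinant.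
    have hF : IsFrame (g.comp p₀ z) fun a => vecComp p₀ _ (b a) := fun a c => by
      rw [← val_symm_eq g p₀ hz]
      exact hb a c
    have := hF.det_eq
    rw [h0] at this
    norm_num at this

variable {g} {U : Set E3} {ι : E3 → M} {n : ∀ x : E3, TangentSpace (𝓡 4) (ι x)}

/-- The map `ι` in the preferred chart around `p₀`. -/
def chartMap (ι : E3 → M) (p₀ : M) (x : E3) : E4 := chartAt E4 p₀ (ι x)

/-- The part of the slice covered by the preferred chart around `p₀`. -/
def chartDomain (U : Set E3) (ι : E3 → M) (p₀ : M) : Set E3 := U ∩ ι ⁻¹' (chartAt E4 p₀).source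

omit [IsManifold (𝓡 4) ∞ M] in
theorem mem_chartDomain {x : E3} (hx : x ∈ U) : x ∈ chartDomain U ι (ι x) :=
  ⟨hx, mem_chart_source E4 (ι x)⟩

namespace IsFlatSlice

variable (h : IsFlatSlice g U ι n)
include h

omit [IsManifold (𝓡 4) ∞ M] in
theorem isOpen_chartDomain (p₀ : M) : IsOpen (chartDomain U ι p₀) :=
  h.smooth.continuousOn.isOpen_inter_preimage h.isOpen (chartAt E4 p₀).open_source

omit [IsManifold (𝓡 4) ∞ M] in
theorem mdifferentiableAt {x : E3} (hx : x ∈ U) : MDifferentiableAt (𝓡 3) (𝓡 4) ι x :=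
  (h.smooth.contMDiffAt (h.isOpen.mem_nhds hx)).mdifferentiableAt (by simp)

theorem tvec_chartMap (p₀ : M) {x : E3} (hx : x ∈ chartDomain U ι p₀) (i : Fin 3) :
    tvec (chartMap ι p₀) i x = vecComp p₀ (ι x) (tangentVec ι x i) := by
  have h1 := mfderiv_comp x (mdifferentiableAt_chart hx.2) (h.mdifferentiableAt hx.1)
  have h2 : MDifferentiableAt (𝓡 3) (𝓡 4) (chartMap ι p₀) x :=
    (mdifferentiableAt_chart hx.2).comp x (h.mdifferentiableAt hx.1)
  funext μ
  have h3 : fderiv ℝ (chartMap ι p₀) x (EuclideanSpace.single i (1 : ℝ))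
      = chartVec p₀ (ι x) (tangentVec ι x i) := by
    rw [← mfderiv_eq_fderiv]
    exact congrArg (fun L : E3 →L[ℝ] E4 => L (EuclideanSpace.single i (1 : ℝ))) h1
  rw [tvec, pderiv_component h2.differentiableAt, h3, chartVec_apply]

theorem isFlatSliceIn (p₀ : M) : IsFlatSliceIn (g.comp p₀) (chartAt E4 p₀).target
    (chartDomain U ι p₀) (chartMap ι p₀) (fun x => (chartVec p₀ (ι x) (n x)).ofLp) where
  metric := isMetricOn_comp g p₀
  map :=
    { isOpen := h.isOpen_chartDomain p₀
      smooth := by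
        rw [← contMDiffOn_iff_contDiffOn]
        exact (contMDiffOn_chart (I := 𝓡 4) (n := ∞) (x := p₀)).comp
          (h.smooth.mono Set.inter_subset_left) fun x hx => hx.2
      mapsTo := fun x hx => (chartAt E4 p₀).map_source hx.2 }
  smooth μ := h.smooth_normal p₀ μ
  flat x hx i j := by
    rw [h.tvec_chartMap p₀ hx, h.tvec_chartMap p₀ hx, chartMap, ← val_eq g p₀ hx.2]
    exact h.flat x hx.1 i j
  unit x hx := (val_eq g p₀ hx.2 _ _).symm.trans (h.unit_normal x hx.1)
  normal x hx i := by
    rw [h.tvec_chartMap p₀ hx]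
    exact (val_eq g p₀ hx.2 _ _).symm.trans (h.normal x hx.1 i)

theorem extrinsicCurv_eq_self {x : E3} (hx : x ∈ U) (i j : Fin 3) :
    extrinsicCurv g ι n x i j = extrinsicIn (g.comp (ι x)) (chartMap ι (ι x))
      (fun z => (chartVec (ι x) (ι z) (n z)).ofLp) i j x := by
  have h1 : covDerivNormal g ι n x i = covD (g.comp (ι x)) (chartMap ι (ι x)) i
      (fun z => (chartVec (ι x) (ι z) (n z)).ofLp) x := by
    funext μ
    rw [covDerivNormal, covD, Finset.sum_comm]
    simp_rw [connForm, Finset.sum_mul]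
    have h2 : ∀ α, pderiv i (fun z => chartMap ι (ι x) z α) x
        = vecComp (ι x) (ι x) (tangentVec ι x i) α := fun α =>
      congrFun (h.tvec_chartMap (ι x) (mem_chartDomain hx) i) α
    simp_rw [h2]
    rfl
  rw [extrinsicCurv, extrinsicIn, h.tvec_chartMap (ι x) (mem_chartDomain hx), h1]
  rfl

theorem extrinsicIn_chart (p₀ q₀ : M) {x : E3} (hp : x ∈ chartDomain U ι p₀)
    (hq : x ∈ chartDomain U ι q₀) (i j : Fin 3) :
    extrinsicIn (g.comp p₀) (chartMap ι p₀) (fun z => (chartVec p₀ (ι z) (n z)).ofLp) i j x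
      = extrinsicIn (g.comp q₀) (chartMap ι q₀) (fun z => (chartVec q₀ (ι z) (n z)).ofLp) i j x := by
  set c := chartAt E4 p₀
  set c' := chartAt E4 q₀
  -- Components of vectors transform by the derivative of the transition map, which serves as `τ` in
  -- `extrinsicIn_transition`.
  have htrans : ∀ q : M, q ∈ c.source → q ∈ c'.source → ∀ v : TangentSpace (𝓡 4) q,
      chartVec q₀ q v = fderiv ℝ (fun z => c' (c.symm z)) (c q) (chartVec p₀ q v) := by
    intro q hqc hqc' v
    have hd : MDifferentiableAt (𝓡 4) (𝓡 4) (fun z => c' (c.symm z)) (c q) := by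
      have h1 : MDifferentiableAt (𝓡 4) (𝓡 4) c.symm (c q) :=
        (mdifferentiable_chart p₀).mdifferentiableAt_symm (c.map_source hqc)
      have h2 : MDifferentiableAt (𝓡 4) (𝓡 4) c' (c.symm (c q)) := by
        rw [c.left_inv hqc]
        exact mdifferentiableAt_chart hqc'
      exact h2.comp (c q) h1
    have hE : c' =ᶠ[nhds q] (fun z => c' (c.symm z)) ∘ c := by
      filter_upwards [c.open_source.mem_nhds hqc] with w hw
      simp [c.left_inv hw]
    have h1 : mfderiv (𝓡 4) (𝓡 4) c' q = mfderiv (𝓡 4) (𝓡 4) ((fun z => c' (c.symm z)) ∘ c) q :=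
      hE.mfderiv_eq
    rw [mfderiv_comp q hd (mdifferentiableAt_chart hqc), mfderiv_eq_fderiv] at h1
    exact congrArg (fun L : E4 →L[ℝ] E4 => L v) h1
  have hev : ∀ᶠ z in nhds x, z ∈ chartDomain U ι p₀ ∧ z ∈ chartDomain U ι q₀ :=
    ((h.isOpen_chartDomain p₀).eventually_mem hp).and ((h.isOpen_chartDomain q₀).eventually_mem hq)
  refine extrinsicIn_transition (O := (c.symm.trans c').source) (τ := fun z => c' (c.symm z))
    (h.isFlatSliceIn p₀) (h.isFlatSliceIn q₀) hp hq (c.symm.trans c').open_source ?_ ?_ ?_ ?_ ?_ i j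
  · have := (contDiffGroupoid ∞ (𝓡 4)).compatible (chart_mem_atlas E4 p₀) (chart_mem_atlas E4 q₀)
    rw [contDiffGroupoid, mem_groupoid_of_pregroupoid] at this
    have h1 := this.1
    simp only [contDiffPregroupoid, modelWithCornersSelf_coe, modelWithCornersSelf_coe_symm,
      Function.comp_id, Function.id_comp, Set.preimage_id, Set.range_id, Set.inter_univ] at h1
    exact h1
  · rw [OpenPartialHomeomorph.trans_source]
    refine ⟨c.map_source hp.2, ?_⟩
    change c.symm (c (ι x)) ∈ c'.source
    rw [c.left_inv hp.2]
    exact hq.2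
  · filter_upwards [hev] with z hz
    change c' (ι z) = c' (c.symm (c (ι z)))
    rw [c.left_inv hz.1.2]
  · filter_upwards [hev] with z hz using htrans _ hz.1.2 hz.2.2 _
  · intro z hz v w
    rw [OpenPartialHomeomorph.trans_source] at hz
    have hzt : z ∈ c.target := hz.1
    have hzs : c.symm z ∈ c'.source := hz.2
    have hsurj : ∀ v : E4, ∃ u : TangentSpace (𝓡 4) (c.symm z), chartVec p₀ (c.symm z) u = v :=
      fun v => ⟨mfderiv (𝓡 4) (𝓡 4) c.symm z v, congrArg (fun L : E4 →L[ℝ] E4 => L v)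
        ((mdifferentiable_chart p₀).comp_symm_deriv hzt)⟩
    obtain ⟨v, rfl⟩ := hsurj v
    obtain ⟨w, rfl⟩ := hsurj w
    have e1 := val_symm_eq g p₀ hzt v w
    have e2 := val_eq g q₀ hzs v w
    have e3 := htrans _ (c.map_target hzt) hzs v
    have e4 := htrans _ (c.map_target hzt) hzs w
    rw [c.right_inv hzt] at e3 e4
    rw [← e3, ← e4]
    exact e1.symm.trans e2

/-- The chart in the definition of `extrinsicCurv` varies with the point. Here it is replaced by one
fixed chart on a whole neighbourhood, as smoothness and differentiation require. -/
theorem extrinsicCurv_eq (p₀ : M) {x : E3} (hx : x ∈ chartDomain U ι p₀) (i j : Fin 3) :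
    extrinsicCurv g ι n x i j = extrinsicIn (g.comp p₀) (chartMap ι p₀)
      (fun z => (chartVec p₀ (ι z) (n z)).ofLp) i j x :=
  (h.extrinsicCurv_eq_self hx.1 i j).trans
    (h.extrinsicIn_chart _ _ (mem_chartDomain hx.1) hx i j)

theorem eventuallyEq_extrinsicCurv {x : E3} (hx : x ∈ U) (i j : Fin 3) :
    (fun z => extrinsicCurv g ι n z i j) =ᶠ[nhds x] extrinsicIn (g.comp (ι x)) (chartMap ι (ι x))
      (fun z => (chartVec (ι x) (ι z) (n z)).ofLp) i j := by
  filter_upwards [(h.isOpen_chartDomain (ι x)).mem_nhds (mem_chartDomain hx)] with z hz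
    using h.extrinsicCurv_eq (ι x) hz i j

theorem smooth_extrinsicCurv (i j : Fin 3) :
    ContDiffOn ℝ ∞ (fun x => extrinsicCurv g ι n x i j) U := by
  intro x hx
  have h1 := ((h.isFlatSliceIn (ι x)).smooth_extrinsicIn i j).contDiffAt
    ((h.isOpen_chartDomain (ι x)).mem_nhds (mem_chartDomain hx))
  exact (h1.congr_of_eventuallyEq (h.eventuallyEq_extrinsicCurv hx i j)).contDiffWithinAt

theorem extrinsicCurv_symm {x : E3} (hx : x ∈ U) (i j : Fin 3) :
    extrinsicCurv g ι n x i j = extrinsicCurv g ι n x j i := by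
  rw [h.extrinsicCurv_eq_self hx, h.extrinsicCurv_eq_self hx,
    (h.isFlatSliceIn (ι x)).extrinsicIn_symm (mem_chartDomain hx)]

variable (hvac : g.IsVacuum)
include hvac

theorem momentum {x : E3} (hx : x ∈ U) (b : Fin 3) :
    ∑ i, pderiv i (fun z => extrinsicCurv g ι n z b i) x
      = ∑ i, pderiv b (fun z => extrinsicCurv g ι n z i i) x := by
  simp_rw [pderiv_congr (h.eventuallyEq_extrinsicCurv hx _ _)]
  exact (h.isFlatSliceIn (ι x)).momentum_constraint (mem_chartDomain hx) (hvac (ι x)) b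

theorem magneticPart_eq {x : E3} (hx : x ∈ U) (i j : Fin 3) :
    magneticPart g ι n x i j
      = - ∑ a, ∑ b, leviCivita ![j, a, b] * pderiv a (fun z => extrinsicCurv g ι n z b i) x := by
  simp_rw [pderiv_congr (h.eventuallyEq_extrinsicCurv hx _ _)]
  rw [← (h.isFlatSliceIn (ι x)).magnetic_eq (mem_chartDomain hx) (hvac (ι x)) i j]
  have hF : frameMatrix ι n x = (Matrix.of (sliceFrame (chartMap ι (ι x))
      (fun z => (chartVec (ι x) (ι z) (n z)).ofLp) x)).transpose := by
    ext μ a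
    refine Fin.cases rfl (fun i => ?_) a
    simp only [frameMatrix, Matrix.of_apply, Matrix.transpose_apply, sliceFrame, Fin.cons_succ]
    rw [h.tvec_chartMap (ι x) (mem_chartDomain hx)]
  rw [magneticPart, hF]
  simp_rw [h.tvec_chartMap (ι x) (mem_chartDomain hx)]
  rfl

end IsFlatSlice

end Charts

/-! ## The difference of the two flux densities is a curl -/

section Curl

/-- The curl `ε_{iab} ∂_a V_b` of a vector field on `ℝ³`. -/
def curl (V : E3 → Fin 3 → ℝ) (x : E3) (i : Fin 3) : ℝ :=
  ∑ a, ∑ b, leviCivita ![i, a, b] * pderiv a (fun z => V z b) x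

theorem leviCivita_three (a b c : Fin 3) : leviCivita ![a, b, c]
    = delta a 0 * delta b 1 * delta c 2 - delta a 0 * delta b 2 * delta c 1
      - delta a 1 * delta b 0 * delta c 2 + delta a 1 * delta b 2 * delta c 0
      + delta a 2 * delta b 0 * delta c 1 - delta a 2 * delta b 1 * delta c 0 := by
  rw [leviCivita, Matrix.det_fin_three]
  rfl

/-- Here `D a b c` stands for `∂_a K_{bc}`. On the right, the `x`-terms give `B·ℛ_k` once the free
index of the curl is exchanged with `j`; the terms without `x` come from `∂_a ℛ_k^j = ε_{kaj}`, and
`ε_{iab} ε_{kaj} = δ_{bj} δ_{ik} - δ_{bk} δ_{ij}` turns them into `-P_{ik}`. -/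
theorem curl_contraction {D : Fin 3 → Fin 3 → Fin 3 → ℝ} {K : Fin 3 → Fin 3 → ℝ}
    (hK : ∀ a b, K a b = K b a)
    (hm : ∀ b, ∑ i, D i b i = ∑ i, D b i i) (x : Fin 3 → ℝ) (i k : Fin 3) :
    ∑ j, (- ∑ a, ∑ b, leviCivita ![j, a, b] * D a b i) * (∑ l, leviCivita ![k, l, j] * x l)
        - ∑ j, (- K i j + (∑ l, K l l) * delta i j) * delta k j
      = ∑ a, ∑ b, leviCivita ![i, a, b] *
        (- ∑ l, ∑ j, leviCivita ![k, l, j] * (delta a l * K b j + x l * D a b j)) := by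
  -- The skew part of the row-wise curl is the divergence minus the gradient of the trace, which
  -- `hm` sets to zero.
  have hB : ∀ i j, ∑ a, ∑ b, leviCivita ![j, a, b] * D a b i
      = ∑ a, ∑ b, leviCivita ![i, a, b] * D a b j := by
    have m0 := hm 0
    have m1 := hm 1
    have m2 := hm 2
    simp only [Fin.sum_univ_three] at m0 m1 m2
    intro i j
    fin_cases i <;> fin_cases j <;>
      simp [Fin.sum_univ_three, leviCivita_three, delta] <;>
      linarith
  simp_rw [hB i]
  have k1 := hK 1 0
  have k2 := hK 2 0
  have k3 := hK 2 1
  fin_cases i <;> fin_cases k <;>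
    simp [Fin.sum_univ_three, leviCivita_three, delta, k1, k2, k3] <;> ring

variable {M : Type*} [TopologicalSpace M] [ChartedSpace E4 M] [IsManifold (𝓡 4) ∞ M]
  {g : LorentzMetric M} {U : Set E3} {ι : E3 → M} {n : ∀ x : E3, TangentSpace (𝓡 4) (ι x)}

/-- The vector potential `-K_{bj} ℛ_k^j`. -/
def potential (g : LorentzMetric M) (ι : E3 → M) (n : ∀ x : E3, TangentSpace (𝓡 4) (ι x))
    (k : Fin 3) (x : E3) (b : Fin 3) : ℝ :=
  - ∑ l, ∑ j, leviCivita ![k, l, j] * (x l * extrinsicCurv g ι n x b j)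

namespace IsFlatSlice

variable (h : IsFlatSlice g U ι n)
include h

theorem smooth_potential (k b : Fin 3) : ContDiffOn ℝ ∞ (fun x => potential g ι n k x b) U := by
  refine ContDiffOn.neg (ContDiffOn.sum fun l _ => ContDiffOn.sum fun j _ =>
    contDiffOn_const.mul (ContDiffOn.mul ?_ (h.smooth_extrinsicCurv b j)))
  exact (EuclideanSpace.proj l : E3 →L[ℝ] ℝ).contDiff.contDiffOn

theorem differentiableAt_extrinsicCurv {x : E3} (hx : x ∈ U) (i j : Fin 3) :
    DifferentiableAt ℝ (fun x => extrinsicCurv g ι n x i j) x :=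
  ((h.smooth_extrinsicCurv i j).contDiffAt (h.isOpen.mem_nhds hx)).differentiableAt (by simp)

theorem pderiv_potential {x : E3} (hx : x ∈ U) (k a b : Fin 3) :
    pderiv a (fun z => potential g ι n k z b) x = - ∑ l, ∑ j, leviCivita ![k, l, j] *
      (delta a l * extrinsicCurv g ι n x b j
        + x l * pderiv a (fun z => extrinsicCurv g ι n z b j) x) := by
  have hc : ∀ l, DifferentiableAt ℝ (fun z : E3 => z l) x := fun l =>
    (EuclideanSpace.proj l : E3 →L[ℝ] ℝ).differentiableAt
  have hp : ∀ l j, DifferentiableAt ℝ (fun z : E3 => z l * extrinsicCurv g ι n z b j) x :=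
    fun l j => (hc l).mul (h.differentiableAt_extrinsicCurv hx b j)
  have hq : ∀ l j, DifferentiableAt ℝ
      (fun z : E3 => leviCivita ![k, l, j] * (z l * extrinsicCurv g ι n z b j)) x :=
    fun l j => (differentiableAt_const _).mul (hp l j)
  unfold potential
  rw [pderiv_neg, pderiv_sum fun l _ => DifferentiableAt.fun_sum fun j _ => hq l j]
  congr 1
  refine Finset.sum_congr rfl fun l _ => ?_
  rw [pderiv_sum fun j _ => hq l j]
  refine Finset.sum_congr rfl fun j _ => ?_
  rw [pderiv_mul (differentiableAt_const _) (hp l j), pderiv_const,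
    pderiv_mul (hc l) (h.differentiableAt_extrinsicCurv hx b j), pderiv_apply]
  ring

theorem continuousOn_admMomentum (i j : Fin 3) :
    ContinuousOn (fun x => admMomentum g ι n x i j) U :=
  ((h.smooth_extrinsicCurv i j).continuousOn.neg).add
    ((continuousOn_finsetSum _ fun l _ => (h.smooth_extrinsicCurv l l).continuousOn).mul
      continuousOn_const)

variable (hvac : g.IsVacuum)
include hvac

/-- The definition uses a different chart and frame matrix at each point, so continuity is read off
from the curl formula instead. -/
theorem continuousOn_magneticPart (i j : Fin 3) :
    ContinuousOn (fun x => magneticPart g ι n x i j) U := by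
  refine ContinuousOn.congr (f := fun x => - ∑ a, ∑ b, leviCivita ![j, a, b]
    * pderiv a (fun z => extrinsicCurv g ι n z b i) x) ?_ fun x hx => h.magneticPart_eq hvac hx i j
  exact (continuousOn_finsetSum _ fun a _ => continuousOn_finsetSum _ fun b _ =>
    continuousOn_const.mul ((h.smooth_extrinsicCurv b i).pderiv h.isOpen a).continuousOn).neg

theorem magnetic_sub_momentum {x : E3} (hx : x ∈ U) (i k : Fin 3) :
    ∑ j, magneticPart g ι n x i j * rotationGen k x j
        - ∑ j, admMomentum g ι n x i j * translationGen k x j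
      = curl (potential g ι n k) x i := by
  simp_rw [h.magneticPart_eq hvac hx, curl, h.pderiv_potential hx]
  exact curl_contraction
    (D := fun a b c => pderiv a (fun z => extrinsicCurv g ι n z b c) x)
    (K := fun a b => extrinsicCurv g ι n x a b) (h.extrinsicCurv_symm hx) (h.momentum hvac hx) (fun l => x l) i k

end IsFlatSlice

end Curl

/-! ## Plane calculus -/

section Plane

open MeasureTheory

theorem map_eq_basis {E : Type*} [AddCommGroup E] [Module ℝ E] (D : E2 →ₗ[ℝ] E) (v : E2) :
    D v = v 0 • D (EuclideanSpace.single 0 1) + v 1 • D (EuclideanSpace.single 1 1) := by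
  have : v = v 0 • EuclideanSpace.single 0 (1 : ℝ) + v 1 • EuclideanSpace.single 1 (1 : ℝ) := by
    ext j
    fin_cases j <;> simp
  conv_lhs => rw [this]
  simp only [map_add, map_smul]

theorem det_plane (L : E2 →L[ℝ] E2) : L.det
    = L (EuclideanSpace.single 0 1) 0 * L (EuclideanSpace.single 1 1) 1
      - L (EuclideanSpace.single 1 1) 0 * L (EuclideanSpace.single 0 1) 1 := by
  rw [ContinuousLinearMap.det, ← LinearMap.det_toMatrix (EuclideanSpace.basisFun (Fin 2) ℝ).toBasis,
    Matrix.det_fin_two]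
  simp [LinearMap.toMatrix_apply]

/-- The coefficient `⟨∂₁w, ∂₂F⟩ - ⟨∂₂w, ∂₁F⟩` of the two-form `d⟨w, dF⟩`. -/
def skewForm (A B : E2 →L[ℝ] E3) : ℝ :=
  inner ℝ (A (EuclideanSpace.single 0 1)) (B (EuclideanSpace.single 1 1))
    - inner ℝ (A (EuclideanSpace.single 1 1)) (B (EuclideanSpace.single 0 1))

/-- The triple product `ν · (D e₁ × D e₂)`. -/
def tripleForm (ν : E3) (D : E2 →L[ℝ] E3) : ℝ :=
  let d₁ : E3 := D (EuclideanSpace.single 0 1)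
  let d₂ : E3 := D (EuclideanSpace.single 1 1)
  ν 0 * (d₁ 1 * d₂ 2 - d₁ 2 * d₂ 1) + ν 1 * (d₁ 2 * d₂ 0 - d₁ 0 * d₂ 2)
    + ν 2 * (d₁ 0 * d₂ 1 - d₁ 1 * d₂ 0)

theorem inner_three (u v : E3) : inner ℝ u v = u 0 * v 0 + u 1 * v 1 + u 2 * v 2 := by
  simp [PiLp.inner_apply, Fin.sum_univ_three, mul_comm]

/-- Coefficients of two-forms on the plane scale by the determinant; `tripleForm_comp` is the same
fact for the oriented area form. -/
theorem skewForm_comp (A B : E2 →L[ℝ] E3) (L : E2 →L[ℝ] E2) :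
    skewForm (A.comp L) (B.comp L) = L.det * skewForm A B := by
  have h : ∀ (D : E2 →L[ℝ] E3) (v : E2), D v
      = v 0 • D (EuclideanSpace.single 0 1) + v 1 • D (EuclideanSpace.single 1 1) :=
    fun D v => map_eq_basis D.toLinearMap v
  rw [det_plane]
  simp only [skewForm, ContinuousLinearMap.comp_apply]
  rw [h A (L (EuclideanSpace.single 0 1)), h A (L (EuclideanSpace.single 1 1)),
    h B (L (EuclideanSpace.single 0 1)), h B (L (EuclideanSpace.single 1 1))]
  simp only [inner_three, PiLp.add_apply, PiLp.smul_apply, smul_eq_mul]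
  ring

theorem tripleForm_comp (ν : E3) (D : E2 →L[ℝ] E3) (L : E2 →L[ℝ] E2) :
    tripleForm ν (D.comp L) = L.det * tripleForm ν D := by
  have h : ∀ (v : E2), D v
      = v 0 • D (EuclideanSpace.single 0 1) + v 1 • D (EuclideanSpace.single 1 1) :=
    fun v => map_eq_basis D.toLinearMap v
  rw [det_plane]
  simp only [tripleForm, ContinuousLinearMap.comp_apply]
  rw [h (L (EuclideanSpace.single 0 1)), h (L (EuclideanSpace.single 1 1))]
  simp only [PiLp.add_apply, PiLp.smul_apply, smul_eq_mul]
  ring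

/-! ### Area element and unit normal -/

section Normal

variable {ν : E3} {D : E2 →L[ℝ] E3} (h1 : ‖ν‖ = 1) (h2 : ∀ v, inner ℝ ν (D v) = 0)
include h1 h2

/-- The vector product of the tangent vectors is a multiple of the unit normal. -/
theorem cross_eq :
    (D (EuclideanSpace.single 0 1) 1 * D (EuclideanSpace.single 1 1) 2
      - D (EuclideanSpace.single 0 1) 2 * D (EuclideanSpace.single 1 1) 1 = tripleForm ν D * ν 0) ∧
    (D (EuclideanSpace.single 0 1) 2 * D (EuclideanSpace.single 1 1) 0
      - D (EuclideanSpace.single 0 1) 0 * D (EuclideanSpace.single 1 1) 2 = tripleForm ν D * ν 1) ∧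
    (D (EuclideanSpace.single 0 1) 0 * D (EuclideanSpace.single 1 1) 1
      - D (EuclideanSpace.single 0 1) 1 * D (EuclideanSpace.single 1 1) 0
      = tripleForm ν D * ν 2) := by
  have hn : ν 0 * ν 0 + ν 1 * ν 1 + ν 2 * ν 2 = 1 := by
    rw [← inner_three, real_inner_self_eq_norm_sq, h1, one_pow]
  have a1 := h2 (EuclideanSpace.single 0 1)
  have a2 := h2 (EuclideanSpace.single 1 1)
  rw [inner_three] at a1 a2
  simp only [tripleForm]
  set p := D (EuclideanSpace.single 0 1)
  set q := D (EuclideanSpace.single 1 1)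
  refine ⟨?_, ?_, ?_⟩
  -- Componentwise this is `|ν|² (p × q) - (ν · (p × q)) ν = (ν · p)(ν × q) - (ν · q)(ν × p)`; the
  -- multipliers of `a1` and `a2` are the components of `ν × q` and `-(ν × p)`.
  · linear_combination (-(p 1 * q 2 - p 2 * q 1)) * hn + (ν 1 * q 2 - ν 2 * q 1) * a1
      + (ν 2 * p 1 - ν 1 * p 2) * a2
  · linear_combination (-(p 2 * q 0 - p 0 * q 2)) * hn + (ν 2 * q 0 - ν 0 * q 2) * a1
      + (ν 0 * p 2 - ν 2 * p 0) * a2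
  · linear_combination (-(p 0 * q 1 - p 1 * q 0)) * hn + (ν 0 * q 1 - ν 1 * q 0) * a1
      + (ν 1 * p 0 - ν 0 * p 1) * a2

/-- Lagrange's identity: the Gram determinant is `|p × q|²`, and `p × q` is `tripleForm ν D` times a
unit vector. Hence the area density is the absolute value of the triple product. -/
theorem gram_eq : ‖D (EuclideanSpace.single 0 1)‖ ^ 2 * ‖D (EuclideanSpace.single 1 1)‖ ^ 2
    - (inner ℝ (D (EuclideanSpace.single 0 1)) (D (EuclideanSpace.single 1 1))) ^ 2
      = tripleForm ν D ^ 2 := by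
  obtain ⟨e0, e1, e2⟩ := cross_eq h1 h2
  have hn : ν 0 * ν 0 + ν 1 * ν 1 + ν 2 * ν 2 = 1 := by
    rw [← inner_three, real_inner_self_eq_norm_sq, h1, one_pow]
  set s := tripleForm ν D
  simp only [← real_inner_self_eq_norm_sq, inner_three]
  have : s ^ 2 = (s * ν 0) ^ 2 + (s * ν 1) ^ 2 + (s * ν 2) ^ 2 := by
    linear_combination (- s ^ 2) * hn
  rw [this, ← e0, ← e1, ← e2]
  ring

theorem tripleForm_ne_zero (hD : Function.Injective D) : tripleForm ν D ≠ 0 := by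
  intro h0
  have hg := gram_eq h1 h2
  rw [h0] at hg
  set p := D (EuclideanSpace.single 0 1) with hp
  set q := D (EuclideanSpace.single 1 1) with hq
  -- The vector `|p|² q - ⟨p, q⟩ p` has squared length `|p|²` times the Gram determinant, hence is
  -- zero. Injectivity then forces `p = 0`, and `p = 0` contradicts injectivity again.
  have h3 : D (‖p‖ ^ 2 • EuclideanSpace.single 1 1
      - (inner ℝ p q) • EuclideanSpace.single 0 1) = 0 := by
    rw [← norm_eq_zero, ← sq_eq_zero_iff, ← real_inner_self_eq_norm_sq]
    simp only [map_sub, map_smul, ← hp, ← hq, inner_sub_left, inner_sub_right, inner_smul_left,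
      inner_smul_right, real_inner_self_eq_norm_sq, real_inner_comm p q]
    simp
    linear_combination ‖p‖ ^ 2 * hg
  have h4 := hD (h3.trans (map_zero D).symm)
  have h5 := congrArg (fun v : E2 => v 1) h4
  simp at h5
  have h6 := hD ((hp.symm.trans h5).trans (map_zero D).symm)
  have h7 := congrArg (fun v : E2 => v 0) h6
  simp at h7

end Normal

/-- The curl of `V` paired with the vector product of the tangent vectors. -/
theorem skewForm_eq_curl {V : E3 → E3} {x : E3} (hV : DifferentiableAt ℝ V x) {ν : E3}
    {D : E2 →L[ℝ] E3} (h1 : ‖ν‖ = 1) (h2 : ∀ v, inner ℝ ν (D v) = 0) :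
    skewForm ((fderiv ℝ V x).comp D) D
      = tripleForm ν D * ∑ i, curl (fun z => (V z).ofLp) x i * ν i := by
  obtain ⟨e0, e1, e2⟩ := cross_eq h1 h2
  have hd : ∀ (v : E3) (b : Fin 3), fderiv ℝ V x v b = ∑ a, pderiv a (fun z => V z b) x * v a := by
    intro v b
    rw [← fderiv_eq_sum_pderiv]
    have : HasFDerivAt (fun z => V z b)
        ((EuclideanSpace.proj b : E3 →L[ℝ] ℝ).comp (fderiv ℝ V x)) x :=
      (EuclideanSpace.proj b : E3 →L[ℝ] ℝ).hasFDerivAt.comp x hV.hasFDerivAt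
    rw [this.fderiv]
    rfl
  have e : ∀ C : Fin 3 → ℝ, tripleForm ν D * ∑ i, C i * ν i
      = C 0 * (tripleForm ν D * ν 0) + C 1 * (tripleForm ν D * ν 1)
        + C 2 * (tripleForm ν D * ν 2) := by
    intro C
    rw [Fin.sum_univ_three]
    ring
  rw [e, ← e0, ← e1, ← e2]
  simp only [skewForm, ContinuousLinearMap.comp_apply, inner_three, hd, curl, Fin.sum_univ_three,
    leviCivita_three, delta]
  simp
  ring

/-- The integral of a partial derivative of a compactly supported function vanishes. -/
theorem integral_fderiv_eq_zero {g : E2 → ℝ} (hg : ContDiff ℝ 1 g) (hc : HasCompactSupport g)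
    (v : E2) : ∫ u, fderiv ℝ g u v = 0 := by
  have h1 : Continuous fun u => fderiv ℝ g u v :=
    (hg.continuous_fderiv one_ne_zero).clm_apply continuous_const
  have h2 : HasCompactSupport fun u => fderiv ℝ g u v := hc.fderiv_apply (𝕜 := ℝ) v
  -- Integration by parts against the constant function `1`.
  have := integral_mul_fderiv_eq_neg_fderiv_mul_of_integrable (μ := (volume : Measure E2))
    (f := fun _ => (1 : ℝ)) (g := g) (v := v) (by simp)
    (by simpa using h1.integrable_of_hasCompactSupport h2)
    (by simpa using hg.continuous.integrable_of_hasCompactSupport hc)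
    (fun _ _ => differentiableAt_const _) (fun _ _ => (hg.differentiable one_ne_zero) _)
  simpa using this

end Plane

/-! ## Stokes' theorem on a closed surface -/

section Stokes

open MeasureTheory

variable {A : Type*} [TopologicalSpace A] [ChartedSpace E2 A]

/-- The function `W` in the preferred chart around `c`. -/
def rep {E : Type*} (c : A) (W : A → E) (u : E2) : E := W ((chartAt E2 c).symm u)

/-- The orientation `±1` of the preferred chart around `c` with respect to the normal `ν`. -/
def chartSign (f ν : A → E3) (c : A) (u : E2) : ℝ :=
  tripleForm (rep c ν u) (fderiv ℝ (rep c f) u) / |tripleForm (rep c ν u) (fderiv ℝ (rep c f) u)|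

/-- The density of the two-form `d⟨W, df⟩` in the preferred chart around `c`, with the orientation
given by `ν`. -/
def stokesDensity (f ν : A → E3) (c : A) (W : A → E3) (u : E2) : ℝ :=
  chartSign f ν c u * skewForm (fderiv ℝ (rep c W) u) (fderiv ℝ (rep c f) u)

/-- The change of coordinates between two preferred charts. -/
abbrev transition (a b : A) : OpenPartialHomeomorph E2 E2 := (chartAt E2 a).symm.trans (chartAt E2 b)

theorem mem_transition_source {a b : A} {u : E2} : u ∈ (transition a b).source ↔
    u ∈ (chartAt E2 a).target ∧ (chartAt E2 a).symm u ∈ (chartAt E2 b).source := by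
  rw [OpenPartialHomeomorph.trans_source]
  rfl

theorem symm_transition {a b : A} {u : E2} (hu : u ∈ (transition a b).source) :
    (chartAt E2 b).symm (transition a b u) = (chartAt E2 a).symm u :=
  (chartAt E2 b).left_inv (mem_transition_source.1 hu).2

variable [IsManifold (𝓡 2) ∞ A]

theorem contDiffOn_rep {E : Type*} [NormedAddCommGroup E] [NormedSpace ℝ E] {W : A → E}
    (hW : ContMDiff (𝓡 2) 𝓘(ℝ, E) ∞ W) (c : A) :
    ContDiffOn ℝ ∞ (rep c W) (chartAt E2 c).target := by
  rw [← contMDiffOn_iff_contDiffOn]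
  exact hW.comp_contMDiffOn (contMDiffOn_chart_symm (I := 𝓡 2) (n := ∞) (x := c))

theorem differentiableAt_rep {E : Type*} [NormedAddCommGroup E] [NormedSpace ℝ E] {W : A → E}
    (hW : ContMDiff (𝓡 2) 𝓘(ℝ, E) ∞ W) {c : A} {u : E2} (hu : u ∈ (chartAt E2 c).target) :
    DifferentiableAt ℝ (rep c W) u :=
  ((contDiffOn_rep hW c).contDiffAt ((chartAt E2 c).open_target.mem_nhds hu)).differentiableAt
    (by simp)

theorem contDiffOn_fderiv_rep {E : Type*} [NormedAddCommGroup E] [NormedSpace ℝ E] {W : A → E}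
    (hW : ContMDiff (𝓡 2) 𝓘(ℝ, E) ∞ W) (c : A) :
    ContDiffOn ℝ ∞ (fderiv ℝ (rep c W)) (chartAt E2 c).target :=
  (contDiffOn_rep hW c).fderiv_of_isOpen (chartAt E2 c).open_target (m := ∞) le_rfl

theorem contDiffOn_transition (a b : A) :
    ContDiffOn ℝ ∞ (transition a b) (transition a b).source := by
  have := (contDiffGroupoid ∞ (𝓡 2)).compatible (chart_mem_atlas E2 a) (chart_mem_atlas E2 b)
  rw [contDiffGroupoid, mem_groupoid_of_pregroupoid] at this
  have h1 := this.1
  simp only [contDiffPregroupoid, modelWithCornersSelf_coe, modelWithCornersSelf_coe_symm,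
    Function.comp_id, Function.id_comp, Set.preimage_id, Set.range_id, Set.inter_univ] at h1
  exact h1

theorem hasFDerivAt_transition {a b : A} {u : E2} (hu : u ∈ (transition a b).source) :
    HasFDerivAt (transition a b) (fderiv ℝ (transition a b) u) u :=
  (((contDiffOn_transition a b).contDiffAt
    ((transition a b).open_source.mem_nhds hu)).differentiableAt (by simp)).hasFDerivAt

theorem fderiv_rep_transition {E : Type*} [NormedAddCommGroup E] [NormedSpace ℝ E] {W : A → E}
    (hW : ContMDiff (𝓡 2) 𝓘(ℝ, E) ∞ W) {a b : A} {u : E2} (hu : u ∈ (transition a b).source) :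
    fderiv ℝ (rep a W) u
      = (fderiv ℝ (rep b W) (transition a b u)).comp (fderiv ℝ (transition a b) u) := by
  have h1 : rep a W =ᶠ[nhds u] rep b W ∘ transition a b := by
    filter_upwards [(transition a b).open_source.mem_nhds hu] with w hw
    change W _ = W _
    rw [symm_transition hw]
  have h2 : transition a b u ∈ (chartAt E2 b).target :=
    (chartAt E2 b).map_source (mem_transition_source.1 hu).2
  rw [h1.fderiv_eq]
  exact ((differentiableAt_rep hW h2).hasFDerivAt.comp u (hasFDerivAt_transition hu)).fderiv

variable {U : Set E3} {f ν : A → E3}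

/-- The two-form scales by `det` and the orientation sign by the sign of `det`, so their product
transforms as a density, which is what the change of variables formula needs. -/
theorem stokesDensity_transition (hf : IsSurfaceIn U f ν) {W : A → E3}
    (hW : ContMDiff (𝓡 2) (𝓡 3) ∞ W) {a b : A} {u : E2} (hu : u ∈ (transition a b).source) :
    stokesDensity f ν a W u
      = |(fderiv ℝ (transition a b) u).det| * stokesDensity f ν b W (transition a b u) := by
  have h1 : rep a ν u = rep b ν (transition a b u) := by
    change ν _ = ν _
    rw [symm_transition hu]
  rw [stokesDensity, chartSign, fderiv_rep_transition hW hu, fderiv_rep_transition hf.smooth hu,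
    skewForm_comp, tripleForm_comp, h1, stokesDensity, chartSign, abs_mul]
  set d := (fderiv ℝ (transition a b) u).det
  -- For `d = 0` both sides vanish, so invertibility of the derivative need not be known here.
  rcases eq_or_ne d 0 with h | h
  · simp [h]
  · have h2 : |d| ≠ 0 := abs_ne_zero.2 h
    rw [mul_div_mul_comm]
    have h3 : d / |d| * d = |d| := by
      rw [div_mul_eq_mul_div, div_eq_iff h2, abs_mul_abs_self]
    linear_combination (tripleForm (rep b ν (transition a b u)) (fderiv ℝ (rep b f)
      (transition a b u)) / |tripleForm (rep b ν (transition a b u)) (fderiv ℝ (rep b f)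
      (transition a b u))| * skewForm (fderiv ℝ (rep b W) (transition a b u)) (fderiv ℝ (rep b f)
      (transition a b u))) * h3

namespace IsSurfaceIn

variable (hf : IsSurfaceIn U f ν)
include hf

theorem fderiv_rep_apply {c : A} {u : E2} (hu : u ∈ (chartAt E2 c).target) (v : E2) :
    fderiv ℝ (rep c f) u v = mfderiv (𝓡 2) (𝓡 3) f ((chartAt E2 c).symm u)
      (mfderiv (𝓡 2) (𝓡 2) (chartAt E2 c).symm u v) := by
  have h1 := mfderiv_comp u ((hf.smooth.mdifferentiable (by simp)) ((chartAt E2 c).symm u))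
    ((mdifferentiable_chart (I := 𝓡 2) c).mdifferentiableAt_symm hu)
  have h2 : fderiv ℝ (rep c f) u = mfderiv (𝓡 2) (𝓡 3) (f ∘ (chartAt E2 c).symm) u :=
    mfderiv_eq_fderiv.symm
  rw [h2]
  exact congrArg (fun L : E2 →L[ℝ] E3 => L v) h1

theorem injective_fderiv_rep {c : A} {u : E2} (hu : u ∈ (chartAt E2 c).target) :
    Function.Injective (fderiv ℝ (rep c f) u) := by
  have h1 : Function.LeftInverse
      (mfderiv (𝓡 2) (𝓡 2) (chartAt E2 c) ((chartAt E2 c).symm u) : E2 → E2)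
      (mfderiv (𝓡 2) (𝓡 2) (chartAt E2 c).symm u : E2 → E2) := fun v =>
    congrArg (fun L : E2 →L[ℝ] E2 => L v)
      ((mdifferentiable_chart (I := 𝓡 2) c).comp_symm_deriv hu)
  intro v w hvw
  rw [hf.fderiv_rep_apply hu, hf.fderiv_rep_apply hu] at hvw
  exact h1.injective (hf.immersion _ hvw)

theorem inner_fderiv_rep {c : A} {u : E2} (hu : u ∈ (chartAt E2 c).target) (v : E2) :
    inner ℝ (rep c ν u) (fderiv ℝ (rep c f) u v) = 0 := by
  rw [hf.fderiv_rep_apply hu]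
  exact hf.normal _ _

theorem triple_ne_zero {c : A} {u : E2} (hu : u ∈ (chartAt E2 c).target) :
    tripleForm (rep c ν u) (fderiv ℝ (rep c f) u) ≠ 0 :=
  tripleForm_ne_zero (hf.unit_normal _) (hf.inner_fderiv_rep hu) (hf.injective_fderiv_rep hu)

theorem areaDensity_eq {c : A} {u : E2} (hu : u ∈ (chartAt E2 c).target) :
    areaDensity f c u = |tripleForm (rep c ν u) (fderiv ℝ (rep c f) u)| := by
  rw [← Real.sqrt_sq_eq_abs, ← gram_eq (ν := rep c ν u) (hf.unit_normal _) (hf.inner_fderiv_rep hu)]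
  rfl

omit [IsManifold (𝓡 2) ∞ A] in
theorem continuousOn_rep_normal (c : A) : ContinuousOn (rep c ν) (chartAt E2 c).target :=
  hf.continuous_normal.comp_continuousOn (chartAt E2 c).continuousOn_symm

omit hf in
theorem continuousOn_fderiv_apply {W : A → E3} (hW : ContMDiff (𝓡 2) (𝓡 3) ∞ W) (c : A) (v : E2) :
    ContinuousOn (fun u => fderiv ℝ (rep c W) u v) (chartAt E2 c).target :=
  (contDiffOn_fderiv_rep hW c).continuousOn.clm_apply continuousOn_const

theorem continuousOn_triple (c : A) :
    ContinuousOn (fun u => tripleForm (rep c ν u) (fderiv ℝ (rep c f) u))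
      (chartAt E2 c).target := by
  have hp : ∀ i : Fin 3, Continuous fun z : E3 => z i := fun i =>
    (EuclideanSpace.proj i : E3 →L[ℝ] ℝ).continuous
  have h1 : ∀ i, ContinuousOn (fun u => rep c ν u i) (chartAt E2 c).target := fun i =>
    (hp i).comp_continuousOn (hf.continuousOn_rep_normal c)
  have h2 : ∀ v i, ContinuousOn (fun u => fderiv ℝ (rep c f) u v i) (chartAt E2 c).target :=
    fun v i => (hp i).comp_continuousOn (continuousOn_fderiv_apply hf.smooth c v)
  unfold tripleForm
  exact (((h1 0).mul (((h2 _ 1).mul (h2 _ 2)).sub ((h2 _ 2).mul (h2 _ 1)))).add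
    ((h1 1).mul (((h2 _ 2).mul (h2 _ 0)).sub ((h2 _ 0).mul (h2 _ 2))))).add
    ((h1 2).mul (((h2 _ 0).mul (h2 _ 1)).sub ((h2 _ 1).mul (h2 _ 0))))

theorem continuousOn_areaDensity (c : A) :
    ContinuousOn (areaDensity f c) (chartAt E2 c).target :=
  (hf.continuousOn_triple c).abs.congr fun _ hu => hf.areaDensity_eq hu

/-- The triple product is continuous and never zero, so its sign is locally constant. Thus the sign
may be treated as a constant under derivatives, although `ν` is merely continuous. -/
theorem chartSign_eventuallyEq {c : A} {u : E2} (hu : u ∈ (chartAt E2 c).target) :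
    chartSign f ν c =ᶠ[nhds u] fun _ => chartSign f ν c u := by
  have hc := (hf.continuousOn_triple c).continuousAt ((chartAt E2 c).open_target.mem_nhds hu)
  rcases lt_or_gt_of_ne (hf.triple_ne_zero hu) with h | h
  · filter_upwards [hc.eventually_lt continuousAt_const h] with w hw
    rw [chartSign, chartSign, abs_of_neg hw, abs_of_neg h, div_neg, div_neg, div_self hw.ne,
      div_self h.ne]
  · filter_upwards [continuousAt_const.eventually_lt hc h] with w hw
    rw [chartSign, chartSign, abs_of_pos hw, abs_of_pos h, div_self hw.ne', div_self h.ne']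

theorem continuousOn_stokesDensity {W : A → E3} (hW : ContMDiff (𝓡 2) (𝓡 3) ∞ W) (c : A) :
    ContinuousOn (stokesDensity f ν c W) (chartAt E2 c).target := by
  refine ((hf.continuousOn_triple c).div (hf.continuousOn_triple c).abs fun u hu =>
    abs_ne_zero.2 (hf.triple_ne_zero hu)).mul (ContinuousOn.sub ?_ ?_)
  · exact (continuousOn_fderiv_apply hW c _).inner (continuousOn_fderiv_apply hf.smooth c _)
  · exact (continuousOn_fderiv_apply hW c _).inner (continuousOn_fderiv_apply hf.smooth c _)

omit hf [IsManifold (𝓡 2) ∞ A] in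
theorem stokesDensity_eq_zero {W : A → E3} {c : A} {u : E2} (hu : u ∈ (chartAt E2 c).target)
    (h : (chartAt E2 c).symm u ∉ tsupport W) : stokesDensity f ν c W u = 0 := by
  have h1 : rep c W =ᶠ[nhds u] fun _ => 0 := by
    have h2 : ContinuousAt (chartAt E2 c).symm u := (chartAt E2 c).continuousAt_symm hu
    filter_upwards [h2.eventually ((isClosed_tsupport W).isOpen_compl.mem_nhds h)] with w hw
    exact image_eq_zero_of_notMem_tsupport (f := W) hw
  rw [stokesDensity, h1.fderiv_eq]
  simp [skewForm]

end IsSurfaceIn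

end Stokes

/-! ### Integration over the closed surface -/

section StokesIntegral

open MeasureTheory

variable {A : Type*} [TopologicalSpace A] [ChartedSpace E2 A]

theorem isCompact_chart_image {c : A} {K : Set A} (hK : IsCompact K)
    (hKs : K ⊆ (chartAt E2 c).source) : IsCompact (chartAt E2 c '' K) :=
  hK.image_of_continuousOn ((chartAt E2 c).continuousOn.mono hKs)

theorem chart_image_subset {c : A} {K : Set A} (hKs : K ⊆ (chartAt E2 c).source) :
    chartAt E2 c '' K ⊆ (chartAt E2 c).target := by
  rintro _ ⟨a, ha, rfl⟩
  exact (chartAt E2 c).map_source (hKs ha)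

theorem symm_notMem {c : A} {K : Set A} {u : E2} (hu : u ∈ (chartAt E2 c).target)
    (h : u ∉ chartAt E2 c '' K) : (chartAt E2 c).symm u ∉ K := fun hK =>
  h ⟨_, hK, (chartAt E2 c).right_inv hu⟩

theorem integrableOn_target {c : A} {K : Set A} (hK : IsCompact K)
    (hKs : K ⊆ (chartAt E2 c).source) {g : E2 → ℝ} (hg : ContinuousOn g (chartAt E2 c).target)
    (h0 : ∀ u ∈ (chartAt E2 c).target, (chartAt E2 c).symm u ∉ K → g u = 0) :
    IntegrableOn g (chartAt E2 c).target := by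
  refine IntegrableOn.of_forall_sdiff_eq_zero ((hg.mono (chart_image_subset hKs)).integrableOn_compact
    (isCompact_chart_image hK hKs)) (chartAt E2 c).open_target.measurableSet fun u hu =>
      h0 u hu.1 (symm_notMem hu.1 hu.2)

variable [IsManifold (𝓡 2) ∞ A] [CompactSpace A] {U : Set E3} {f ν : A → E3}

/-- Stokes' theorem for a form supported in the domain of a chart. -/
theorem IsSurfaceIn.integral_stokesDensity_eq_zero (hf : IsSurfaceIn U f ν) {W : A → E3}
    (hW : ContMDiff (𝓡 2) (𝓡 3) ∞ W) {c : A} (hc : tsupport W ⊆ (chartAt E2 c).source) :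
    ∫ u in (chartAt E2 c).target, stokesDensity f ν c W u = 0 := by
  set T := (chartAt E2 c).target with hT
  have hTo : IsOpen T := (chartAt E2 c).open_target
  set K := chartAt E2 c '' tsupport W with hKdef
  have hK : IsCompact K := isCompact_chart_image (isClosed_tsupport W).isCompact hc
  have hKT : K ⊆ T := chart_image_subset hc
  set p : E2 → E2 → ℝ := fun v u => inner ℝ (rep c W u) (fderiv ℝ (rep c f) u v) with hp
  -- The component of the oriented one-form `⟨W, df⟩` along `v`, extended by zero. It vanishes off
  -- the compact set `K` inside `T`, so the extension to the plane is `C¹`.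
  set g : E2 → E2 → ℝ := fun v => T.indicator fun u => chartSign f ν c u * p v u with hgdef
  have hps : ∀ v, ContDiffOn ℝ ∞ (p v) T := fun v =>
    (contDiffOn_rep hW c).inner ℝ ((contDiffOn_fderiv_rep hf.smooth c).clm_apply contDiffOn_const)
  have hg0 : ∀ v, ∀ u ∉ K, g v u = 0 := by
    intro v u hu
    by_cases huT : u ∈ T
    · have h1 : rep c W u = 0 := image_eq_zero_of_notMem_tsupport (f := W) (symm_notMem huT hu)
      simp [hgdef, hp, h1]
    · simp [hgdef, huT]
  have hgK : ∀ v, ∀ u ∉ K, g v =ᶠ[nhds u] fun _ => 0 := by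
    intro v u hu
    filter_upwards [hK.isClosed.isOpen_compl.mem_nhds hu] with w hw using hg0 v w hw
  have hgT : ∀ v, ∀ u ∈ T, g v =ᶠ[nhds u] fun w => chartSign f ν c u * p v w := by
    intro v u hu
    filter_upwards [hTo.mem_nhds hu, hf.chartSign_eventuallyEq hu] with w hw hw'
    simp only [hgdef, Set.indicator_of_mem hw, hw']
  have hgs : ∀ v, ContDiff ℝ 1 (g v) := by
    intro v
    rw [contDiff_iff_contDiffAt]
    intro u
    by_cases hu : u ∈ T
    · have h1 : ContDiffAt ℝ ∞ (p v) u := (hps v).contDiffAt (hTo.mem_nhds hu)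
      exact ((contDiffAt_const.mul h1).congr_of_eventuallyEq (hgT v u hu)).of_le (by simp)
    · exact contDiffAt_const.congr_of_eventuallyEq (hgK v u fun h => hu (hKT h))
  have hgc : ∀ v, HasCompactSupport (g v) := fun v => HasCompactSupport.intro hK (hg0 v)
  set e0 : E2 := EuclideanSpace.single 0 1
  set e1 : E2 := EuclideanSpace.single 1 1
  -- Exterior derivative of the one-form: the terms with second derivatives of `f` cancel by
  -- symmetry.
  have key : ∀ u, T.indicator (stokesDensity f ν c W) u
      = fderiv ℝ (g e1) u e0 - fderiv ℝ (g e0) u e1 := by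
    intro u
    by_cases hu : u ∈ T
    · have hsm : ContDiffAt ℝ ∞ (rep c f) u :=
        (contDiffOn_rep hf.smooth c).contDiffAt (hTo.mem_nhds hu)
      have hsym : IsSymmSndFDerivAt ℝ (rep c f) u :=
        hsm.isSymmSndFDerivAt (by simpa using ENat.LEInfty.out)
      have hdd : DifferentiableAt ℝ (fderiv ℝ (rep c f)) u :=
        (hsm.fderiv_right (m := ∞) le_rfl).differentiableAt (by simp)
      have h1 : ∀ v w, fderiv ℝ (g v) u w = chartSign f ν c u *
          (inner ℝ (rep c W u) (fderiv ℝ (fderiv ℝ (rep c f)) u w v)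
            + inner ℝ (fderiv ℝ (rep c W) u w) (fderiv ℝ (rep c f) u v)) := by
        intro v w
        have h2 : HasFDerivAt (fun z => fderiv ℝ (rep c f) z v) _ u :=
          hdd.hasFDerivAt.clm_apply (hasFDerivAt_const v u)
        have h3 := ((differentiableAt_rep hW hu).hasFDerivAt.inner ℝ h2).const_mul
          (chartSign f ν c u)
        rw [(hgT v u hu).fderiv_eq, h3.fderiv]
        simp
      rw [Set.indicator_of_mem hu, h1, h1, hsym.eq e0 e1, stokesDensity, skewForm]
      ring
    · have h1 : ∀ v, fderiv ℝ (g v) u = 0 := by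
        intro v
        rw [(hgK v u fun h => hu (hKT h)).fderiv_eq]
        simp
      simp [Set.indicator_of_notMem hu, h1]
  have hint : ∀ v w, Integrable fun u => fderiv ℝ (g v) u w := fun v w =>
    (((hgs v).continuous_fderiv one_ne_zero).clm_apply
      continuous_const).integrable_of_hasCompactSupport ((hgc v).fderiv_apply (𝕜 := ℝ) w)
  rw [← integral_indicator hTo.measurableSet, integral_congr_ae (Filter.Eventually.of_forall key),
    integral_sub (hint _ _) (hint _ _), integral_fderiv_eq_zero (hgs _) (hgc _),
    integral_fderiv_eq_zero (hgs _) (hgc _), sub_zero]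

omit [CompactSpace A] in
/-- The integral of a two-form does not depend on the chart. -/
theorem IsSurfaceIn.integral_change_chart (hf : IsSurfaceIn U f ν) {W : A → E3}
    (hW : ContMDiff (𝓡 2) (𝓡 3) ∞ W) (h : A → ℝ) {a b : A}
    (ha : ∀ q ∉ (chartAt E2 a).source, h q = 0) (hb : tsupport W ⊆ (chartAt E2 b).source) :
    ∫ u in (chartAt E2 a).target, h ((chartAt E2 a).symm u) * stokesDensity f ν a W u
      = ∫ u in (chartAt E2 b).target, h ((chartAt E2 b).symm u) * stokesDensity f ν b W u := by
  have hO : MeasurableSet (transition a b).source := (transition a b).open_source.measurableSet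
  have hba : (transition a b).target = (transition b a).source := by
    rw [← OpenPartialHomeomorph.symm_source, transition, OpenPartialHomeomorph.trans_symm_eq_symm_trans_symm]
    rfl
  -- `h` vanishes off the domain of the chart `a` and `W` is supported in that of `b`, so both
  -- integrals reduce to the overlap of the two charts.
  have h1 : ∫ u in (chartAt E2 a).target, h ((chartAt E2 a).symm u) * stokesDensity f ν a W u
      = ∫ u in (transition a b).source,
        h ((chartAt E2 a).symm u) * stokesDensity f ν a W u := by
    refine setIntegral_eq_of_subset_of_forall_sdiff_eq_zero
      (chartAt E2 a).open_target.measurableSet (fun u hu => (mem_transition_source.1 hu).1)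
      fun u hu => ?_
    rw [stokesDensity_eq_zero hu.1 fun hq => hu.2 (mem_transition_source.2 ⟨hu.1, hb hq⟩), mul_zero]
  have h2 : ∫ u in (chartAt E2 b).target, h ((chartAt E2 b).symm u) * stokesDensity f ν b W u
      = ∫ u in (transition b a).source,
        h ((chartAt E2 b).symm u) * stokesDensity f ν b W u := by
    refine setIntegral_eq_of_subset_of_forall_sdiff_eq_zero
      (chartAt E2 b).open_target.measurableSet (fun u hu => (mem_transition_source.1 hu).1)
      fun u hu => ?_
    rw [ha _ fun hq => hu.2 (mem_transition_source.2 ⟨hu.1, hq⟩), zero_mul]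
  rw [h1, h2, ← hba, ← (transition a b).image_source_eq_target,
    integral_image_eq_integral_abs_det_fderiv_smul volume hO
      (fun u hu => (hasFDerivAt_transition hu).hasFDerivWithinAt) (transition a b).injOn]
  refine setIntegral_congr_fun hO fun u hu => ?_
  simp only [smul_eq_mul]
  rw [stokesDensity_transition hf hW hu, symm_transition hu]
  ring

/-- **Stokes' theorem** for the form `⟨W, df⟩` on a closed surface. -/
theorem IsSurfaceIn.sum_integral_stokesDensity (hf : IsSurfaceIn U f ν) {W : A → E3}
    (hW : ContMDiff (𝓡 2) (𝓡 3) ∞ W) (ρ : SmoothPartitionOfUnity A (𝓡 2) A Set.univ)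
    (hρ : ρ.IsSubordinate fun a => (chartAt E2 a).source) (S : Finset A)
    (hS : ∀ a ∉ S, ∀ q, ρ a q = 0) :
    ∑ a ∈ S, ∫ u in (chartAt E2 a).target,
      ρ a ((chartAt E2 a).symm u) * stokesDensity f ν a W u = 0 := by
  have hsum : ∀ q, ∑ a ∈ S, ρ a q = 1 := by
    intro q
    rw [← ρ.sum_eq_one (Set.mem_univ q), finsum_eq_sum_of_support_subset]
    intro a ha
    by_contra h
    exact ha (hS a h q)
  -- The partition of unity is used a second time, on `W` itself: each `w b` lives in one chart.
  -- After the terms `ρ a · d⟨w b, df⟩` are moved to chart `b`, summing over `a` removes `ρ a` and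
  -- leaves Stokes' theorem in a single chart.
  set w : A → A → E3 := fun b q => ρ b q • W q with hw
  have hws : ∀ b, ContMDiff (𝓡 2) (𝓡 3) ∞ (w b) := fun b => (ρ b).contMDiff.smul hW
  have hwt : ∀ b, tsupport (w b) ⊆ (chartAt E2 b).source := fun b =>
    (tsupport_smul_subset_left (ρ b) W).trans (hρ b)
  have hρ0 : ∀ a, ∀ q ∉ (chartAt E2 a).source, ρ a q = 0 := fun a q hq =>
    image_eq_zero_of_notMem_tsupport fun h => hq (hρ a h)
  have hρc : ∀ a c : A, ContinuousOn (fun u => ρ a ((chartAt E2 c).symm u)) (chartAt E2 c).target :=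
    fun a c => (ρ a).contMDiff.continuous.comp_continuousOn (chartAt E2 c).continuousOn_symm
  have hlin : ∀ a, ∀ u ∈ (chartAt E2 a).target,
      stokesDensity f ν a W u = ∑ b ∈ S, stokesDensity f ν a (w b) u := by
    intro a u hu
    have h1 : rep a W = fun u => ∑ b ∈ S, rep a (w b) u := by
      funext z
      simp only [rep, hw, ← Finset.sum_smul, hsum, one_smul]
    simp only [stokesDensity, ← Finset.mul_sum]
    rw [h1, fderiv_fun_sum fun b _ => differentiableAt_rep (hws b) hu]
    simp [skewForm, sum_inner, Finset.sum_sub_distrib]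
  have hint1 : ∀ a b, IntegrableOn (fun u => ρ a ((chartAt E2 a).symm u)
      * stokesDensity f ν a (w b) u) (chartAt E2 a).target := fun a b =>
    integrableOn_target (isClosed_tsupport (ρ a)).isCompact (hρ a)
      ((hρc a a).mul (hf.continuousOn_stokesDensity (hws b) a)) fun u _ hu => by
        rw [image_eq_zero_of_notMem_tsupport hu, zero_mul]
  have hint2 : ∀ a b, IntegrableOn (fun u => ρ a ((chartAt E2 b).symm u)
      * stokesDensity f ν b (w b) u) (chartAt E2 b).target := fun a b =>
    integrableOn_target (isClosed_tsupport (w b)).isCompact (hwt b)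
      ((hρc a b).mul (hf.continuousOn_stokesDensity (hws b) b)) fun u hu hq => by
        rw [stokesDensity_eq_zero hu hq, mul_zero]
  calc ∑ a ∈ S, ∫ u in (chartAt E2 a).target,
        ρ a ((chartAt E2 a).symm u) * stokesDensity f ν a W u
      = ∑ a ∈ S, ∑ b ∈ S, ∫ u in (chartAt E2 a).target,
        ρ a ((chartAt E2 a).symm u) * stokesDensity f ν a (w b) u := by
        refine Finset.sum_congr rfl fun a _ => ?_
        rw [← integral_finsetSum _ fun b _ => hint1 a b]
        refine setIntegral_congr_fun (chartAt E2 a).open_target.measurableSet fun u hu => ?_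
        simp only [hlin a u hu, Finset.mul_sum]
    _ = ∑ b ∈ S, ∑ a ∈ S, ∫ u in (chartAt E2 b).target,
        ρ a ((chartAt E2 b).symm u) * stokesDensity f ν b (w b) u := by
        rw [Finset.sum_comm]
        exact Finset.sum_congr rfl fun b _ => Finset.sum_congr rfl fun a _ =>
          hf.integral_change_chart (hws b) (ρ a) (hρ0 a) (hwt b)
    _ = ∑ b ∈ S, ∫ u in (chartAt E2 b).target, stokesDensity f ν b (w b) u := by
        refine Finset.sum_congr rfl fun b _ => ?_
        rw [← integral_finsetSum _ fun a _ => hint2 a b]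
        refine setIntegral_congr_fun (chartAt E2 b).open_target.measurableSet fun u hu => ?_
        simp only [← Finset.sum_mul, hsum, one_mul]
    _ = 0 := Finset.sum_eq_zero fun b _ => hf.integral_stokesDensity_eq_zero (hws b) (hwt b)

/-- Vector fields which differ by a curl have the same flux through a closed surface. -/
theorem IsSurfaceIn.flux_eq_of_sub_eq_curl (hf : IsSurfaceIn U f ν) (hU : IsOpen U)
    (ρ : SmoothPartitionOfUnity A (𝓡 2) A Set.univ)
    (hρ : ρ.IsSubordinate fun a => (chartAt E2 a).source) {V₁ V₂ Z : E3 → Fin 3 → ℝ}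
    (h₁ : ∀ i, ContinuousOn (fun x => V₁ x i) U) (h₂ : ∀ i, ContinuousOn (fun x => V₂ x i) U)
    (hZ : ∀ i, ContDiffOn ℝ ∞ (fun x => Z x i) U)
    (hcurl : ∀ x ∈ U, ∀ i, V₁ x i - V₂ x i = curl Z x i) :
    flux ρ f ν V₁ = flux ρ f ν V₂ := by
  -- Compactness makes the partition finite, so the `finsum` in `flux` is an honest sum and not its
  -- default value `0`.
  have hfin : {a | (Function.support (ρ a)).Nonempty}.Finite :=
    ρ.locallyFinite.finite_nonempty_of_compact
  set S := hfin.toFinset with hSdef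
  have hS : ∀ a ∉ S, ∀ q, ρ a q = 0 := by
    intro a ha q
    by_contra hq
    exact ha (hfin.mem_toFinset.2 ⟨q, hq⟩)
  have hflux : ∀ V : E3 → Fin 3 → ℝ, flux ρ f ν V = ∑ a ∈ S, ∫ u in (chartAt E2 a).target,
      ρ a ((chartAt E2 a).symm u)
      * (∑ i, V (f ((chartAt E2 a).symm u)) i * ν ((chartAt E2 a).symm u) i)
      * areaDensity f a u := by
    intro V
    refine finsum_eq_sum_of_support_subset _ fun a ha => ?_
    by_contra h
    exact ha (by simp [hS a h])
  have hint : ∀ V : E3 → Fin 3 → ℝ, (∀ i, ContinuousOn (fun x => V x i) U) → ∀ a,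
      IntegrableOn (fun u => ρ a ((chartAt E2 a).symm u)
      * (∑ i, V (f ((chartAt E2 a).symm u)) i * ν ((chartAt E2 a).symm u) i)
      * areaDensity f a u) (chartAt E2 a).target := by
    intro V hV a
    refine integrableOn_target (isClosed_tsupport (ρ a)).isCompact (hρ a) ?_ fun u _ hu => by
      rw [image_eq_zero_of_notMem_tsupport hu, zero_mul, zero_mul]
    have hs := (chartAt E2 a).continuousOn_symm
    refine ((((ρ a).contMDiff.continuous.comp_continuousOn hs).mul
      (continuousOn_finsetSum _ fun i _ => ContinuousOn.mul ?_ ?_)).mul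
        (hf.continuousOn_areaDensity a))
    · exact (hV i).comp (hf.smooth.continuous.comp_continuousOn hs) fun u _ => hf.mem _
    · exact (EuclideanSpace.proj i : E3 →L[ℝ] ℝ).continuous.comp_continuousOn
        (hf.continuousOn_rep_normal a)
  set ZE : E3 → E3 := fun x => WithLp.toLp 2 (Z x) with hZE
  have hZs : ContDiffOn ℝ ∞ ZE U := contDiffOn_euclidean.2 hZ
  have hW : ContMDiff (𝓡 2) (𝓡 3) ∞ (ZE ∘ f) := fun a =>
    ((hZs.contDiffAt (hU.mem_nhds (hf.mem a))).contMDiffAt).comp a (hf.smooth a)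
  -- The zero on the right is replaced by the Stokes integral of `Z ∘ f`, so that the two sides can
  -- be compared chart by chart and pointwise.
  rw [← sub_eq_zero, hflux, hflux, ← Finset.sum_sub_distrib,
    ← hf.sum_integral_stokesDensity hW ρ hρ S hS]
  refine Finset.sum_congr rfl fun a _ => ?_
  rw [← integral_sub (hint V₁ h₁ a) (hint V₂ h₂ a)]
  refine setIntegral_congr_fun (chartAt E2 a).open_target.measurableSet fun u hu => ?_
  have hZd : DifferentiableAt ℝ ZE (rep a f u) :=
    (hZs.contDiffAt (hU.mem_nhds (hf.mem _))).differentiableAt (by simp)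
  have hd : fderiv ℝ (rep a (ZE ∘ f)) u
      = (fderiv ℝ ZE (rep a f u)).comp (fderiv ℝ (rep a f) u) :=
    (hZd.hasFDerivAt.comp u (differentiableAt_rep hf.smooth hu).hasFDerivAt).fderiv
  have hs : ∀ i, V₁ (rep a f u) i * rep a ν u i - V₂ (rep a f u) i * rep a ν u i
      = curl (fun z => (ZE z).ofLp) (rep a f u) i * rep a ν u i := fun i => by
    rw [← sub_mul, hcurl (rep a f u) (hf.mem _)]
  have hsum : ∑ i, V₁ (rep a f u) i * rep a ν u i - ∑ i, V₂ (rep a f u) i * rep a ν u i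
      = ∑ i, curl (fun z => (ZE z).ofLp) (rep a f u) i * rep a ν u i := by
    rw [← Finset.sum_sub_distrib]
    exact Finset.sum_congr rfl fun i _ => hs i
  have ht := hf.triple_ne_zero hu
  -- The orientation sign times the triple product is the area density: this converts the oriented
  -- two-form into `ν_i dS`.
  have hsgn : ∀ t : ℝ, t ≠ 0 → t / |t| * t = |t| := by
    intro t ht
    rw [div_mul_eq_mul_div, div_eq_iff (abs_ne_zero.2 ht), abs_mul_abs_self]
  change ρ a ((chartAt E2 a).symm u) * (∑ i, V₁ (rep a f u) i * rep a ν u i) * areaDensity f a u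
    - ρ a ((chartAt E2 a).symm u) * (∑ i, V₂ (rep a f u) i * rep a ν u i) * areaDensity f a u = _
  rw [← sub_mul, ← mul_sub, hsum, stokesDensity, hd,
    skewForm_eq_curl hZd (hf.unit_normal _) (hf.inner_fderiv_rep hu), hf.areaDensity_eq hu,
    ← hsgn _ ht, chartSign]
  simp only [rep]
  ring

end StokesIntegral

end FlatSlice

end

theorem mainTheorem4
    {M : Type*} [TopologicalSpace M] [ChartedSpace FlatSlice.E4 M] [IsManifold (𝓡 4) ∞ M]
    (g : FlatSlice.LorentzMetric M) (hvac : g.IsVacuum)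
    (U : Set FlatSlice.E3) (ι : FlatSlice.E3 → M)
    (n : ∀ x : FlatSlice.E3, TangentSpace (𝓡 4) (ι x))
    (hslice : FlatSlice.IsFlatSlice g U ι n)
    (hdiv : ∀ x ∈ U, ∀ j : Fin 3,
      ∑ i : Fin 3, FlatSlice.pderiv i (fun z => FlatSlice.magneticPart g ι n z i j) x = 0)
    {A : Type*} [TopologicalSpace A] [ChartedSpace FlatSlice.E2 A] [IsManifold (𝓡 2) ∞ A]
    [T2Space A] [CompactSpace A]
    (f ν : A → FlatSlice.E3) (hf : FlatSlice.IsSurfaceIn U f ν)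
    (ρ : SmoothPartitionOfUnity A (𝓡 2) A Set.univ)
    (hρ : ρ.IsSubordinate fun a => (chartAt FlatSlice.E2 a).source)
    (k : Fin 3) :
    FlatSlice.flux ρ f ν
        (fun x i => ∑ j, FlatSlice.magneticPart g ι n x i j * FlatSlice.rotationGen k x j)
      = FlatSlice.flux ρ f ν
        (fun x i => ∑ j, FlatSlice.admMomentum g ι n x i j * FlatSlice.translationGen k x j) := by
  -- The hypothesis `hdiv` is redundant: by the Codazzi equation `B` is a curl, hence divergence free.
  refine hf.flux_eq_of_sub_eq_curl hslice.isOpen ρ hρ (Z := FlatSlice.potential g ι n k) (fun i => ?_)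
    (fun i => ?_) (fun i => hslice.smooth_potential k i)
    fun x hx i => hslice.magnetic_sub_momentum hvac hx i k
  · refine continuousOn_finsetSum _ fun j _ =>
      (hslice.continuousOn_magneticPart hvac i j).mul (Continuous.continuousOn ?_)
    unfold FlatSlice.rotationGen
    exact continuous_finsetSum _ fun l _ => continuous_const.mul
      (EuclideanSpace.proj l : FlatSlice.E3 →L[ℝ] ℝ).continuous
  · exact continuousOn_finsetSum _ fun j _ =>
      (hslice.continuousOn_admMomentum i j).mul continuousOn_const
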